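/- **Setting.** Offers for an asset arrive according to a Poisson process of rate $\lambda>0$: the inter-arrival times $D_1,D_2,\dots$ are exponential with rate $\lambda$. The offers $X_1,X_2,\dots$ are random variables with CDF $F$ and $E[(X_1)_+]<\infty$. The residual price $X_0$ is integrable with mean $\mu_0=E[X_0]$. All the $D_i$, the $X_i$ and $X_0$ are mutually independent. Put $M=\sup\{x: F(x)<1\}\in(-\infty,+\infty]$ and assume $0\le\mu_0<M$. Let $\phi(x)=\int_x^\infty(1-F(u))\,du$. For a marketing period $t\ge 0$ let $t_0=t$ and $t_i=\max(t_{i-1}-D_i,0)$. A policy is a Borel set $A\subset\mathbb R^2$; the offer $X_i$, arriving when the remaining time is $t_i>0$, is accepted iff $(t_i,X_i)\in A$. The process ends at the first $i\ge 1$ with $t_i=0$ (the deadline is reached, and the sale price is $S_t=X_0$) or with $t_i>0$ and $X_i$ accepted (the sale price is $S_t=X_i$); the time to sale is $T_t=t-t_i$. A policy is optimal if, for every $t\ge0$, its sale price $S_t$ is integrable and it maximizes $E[S_t]$ among all policies for which $S_t$ is integrable. Let $\mu(t)$ be the supremum of $E[S_t]$ over all policies for which $S_t$ is integrable. **Theorem.**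 The policy that accepts an offer $x$ at remaining time $s>0$ iff $x\ge\mu(s)$ is optimal. Let $T_t$ be the time to sale under any optimal policy. For $\gamma>0$ let $$\hat H_\gamma(s)=\begin{cases}0 & s<0\\ 1-(1-s)^\gamma & 0\le s<1\\ 1& s\ge 1.\end{cases}$$ 1. (Support bounded from above.) If $M<\infty$ and, for some $p>0$, $c>0$, $\lim_{x\to M-}\phi(x)/(M-x)^{p+1}=c$, then, as $t\to\infty$, $T_t/t$ converges in distribution to the law with CDF $\hat H_\gamma$, $\gamma=1+\frac1p$; moreover $P(T_t/t\le s)\to\hat H_\gamma(s)$ for every real $s$. In addition $$\lim_{t\to\infty}\frac{E[T_t]}{t}=\lim_{t\to\infty}E\Big[\frac{T_t}{t}\Big]=\frac{p}{2p+1},\qquad \lim_{t\to\infty}\frac{\mathrm{Var}[T_t]}{t^2}=\lim_{t\to\infty}\mathrm{Var}\Big[\frac{T_t}{t}\Big]=\frac{p^2(p+1)}{(2p+1)^2(3p+1)}.$$ 2. (Exponential tail.) If $M=+\infty$ and $\lim_{x\to\infty}\phi(x)\big/\int_x^\infty\phi(u)\,du=c$ for some $c>0$, the same convergence holds with $\gamma=1$,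 and the limits of the mean and of the variance of $T_t/t$ (equivalently of $E[T_t]/t$ and $\mathrm{Var}[T_t]/t^2$) are $\frac12$ and $\frac1{12}$. 3. (Power-law tail.) If $M=+\infty$ and $\lim_{x\to\infty}x\phi(x)\big/\int_x^\infty\phi(u)\,du=p$ for some $p>0$, the same convergence holds with $\gamma=\frac{p+1}{p+2}$, and the limits of the mean and of the variance of $T_t/t$ (equivalently of $E[T_t]/t$ and $\mathrm{Var}[T_t]/t^2$) are $\frac{p+2}{2p+3}$ and $\frac{(p+1)(p+2)^2}{(3p+5)(2p+3)^2}$. In all three cases $T_t$ is square integrable for every $t\ge0$. -/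

import Mathlib

open MeasureTheory ProbabilityTheory Filter Topology Set

noncomputable section

namespace CayleyMoser

/-! ### The bidding process -/

/-- The randomness of the bidding process: the `(n+1)`-st offer arrives a time `D n` after the
`n`-th one (after the start, for `n = 0`) and has size `X n`; `X₀` is the residual price, paid if
the deadline is reached. Inter-arrival times are exponential with rate `lam`, offers have law `ν`,
the residual price has law `ν₀`, and all these random variables are mutually independent. -/
structure IsBiddingProcess {Ω : Type*} [MeasurableSpace Ω] (P : Measure Ω) (lam : ℝ)
    (ν ν₀ : Measure ℝ) (D X : ℕ → Ω → ℝ) (X₀ : Ω → ℝ) : Prop where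
  measurable_D : ∀ n, Measurable (D n)
  measurable_X : ∀ n, Measurable (X n)
  measurable_X₀ : Measurable X₀
  law_D : ∀ n, P.map (D n) = expMeasure lam
  law_X : ∀ n, P.map (X n) = ν
  law_X₀ : P.map X₀ = ν₀
  indep : iIndepFun (Sum.elim D (Sum.elim X (fun _ : Unit => X₀))) P

section Bidding

variable {Ω : Type*} (D X : ℕ → Ω → ℝ) (X₀ : Ω → ℝ)

/-- Time remaining when the `n`-th offer arrives, for a marketing period `t`:
`t_0 = t`, `t_{n+1} = (t_n - D)_+`; it vanishes once the deadline is reached. -/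
def remaining (t : ℝ) : ℕ → Ω → ℝ
  | 0, _ => t
  | n + 1, ω => max (remaining t n ω - D n ω) 0

/-- A policy is a set `A` of pairs (time remaining, offer), namely those that are accepted.
The process ends at the step `n` (counted from `0`) at which the deadline has been reached or the
offer `X n` is accepted; this is the first such step (it exists almost surely). -/
def stopIndex (A : Set (ℝ × ℝ)) (t : ℝ) (ω : Ω) : ℕ :=
  sInf {n : ℕ | remaining D t (n + 1) ω = 0 ∨ (remaining D t (n + 1) ω, X n ω) ∈ A}

/-- The time to sale `T_t` under the policy `A`. -/
def timeToSale (A : Set (ℝ × ℝ)) (t : ℝ) (ω : Ω) : ℝ :=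
  t - remaining D t (stopIndex D X A t ω + 1) ω

open Classical in
/-- The realized sale price `S_t` under the policy `A`. -/
def salePrice (A : Set (ℝ × ℝ)) (t : ℝ) (ω : Ω) : ℝ :=
  if remaining D t (stopIndex D X A t ω + 1) ω = 0 then X₀ ω else X (stopIndex D X A t ω) ω

end Bidding

/-! ### Optimal policies -/

section Optimal

variable {Ω : Type*} [MeasurableSpace Ω] (P : Measure Ω) (D X : ℕ → Ω → ℝ) (X₀ : Ω → ℝ)

/-- A policy is optimal if, whatever the marketing period, it maximizes the expected sale price
among all policies. (Policies whose sale price is not integrable have expected sale price `-∞`,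
because the positive part of an offer is integrable; they never compete.) -/
structure IsOptimalPolicy (A : Set (ℝ × ℝ)) : Prop where
  measurableSet : MeasurableSet A
  integrable : ∀ t, 0 ≤ t → Integrable (salePrice D X X₀ A t) P
  le : ∀ t, 0 ≤ t → ∀ B : Set (ℝ × ℝ), MeasurableSet B → Integrable (salePrice D X X₀ B t) P →
    ∫ ω, salePrice D X X₀ B t ω ∂P ≤ ∫ ω, salePrice D X X₀ A t ω ∂P

/-- `μ(t)`: the largest expected sale price that can be achieved when the time remaining to the
deadline is `t`. -/
def optimalValue (t : ℝ) : ℝ :=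
  sSup {v : ℝ | ∃ B : Set (ℝ × ℝ), MeasurableSet B ∧ Integrable (salePrice D X X₀ B t) P ∧
    v = ∫ ω, salePrice D X X₀ B t ω ∂P}

/-- The threshold policy: accept an offer `x` at remaining time `s > 0` iff `x ≥ μ(s)`. -/
def thresholdPolicy : Set (ℝ × ℝ) :=
  {q : ℝ × ℝ | 0 < q.1 ∧ optimalValue P D X X₀ q.1 ≤ q.2}

end Optimal

/-! ### The offer distribution -/

/-- `M = sup {x | F x < 1}`, possibly `+∞`, where `F` is the CDF of `ν`. -/
def supportMax (ν : Measure ℝ) : EReal :=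
  ⨆ x ∈ {x : ℝ | cdf ν x < 1}, (x : EReal)

/-- `φ(x) = ∫_x^∞ (1 - F(u)) du`. -/
def phi (ν : Measure ℝ) (x : ℝ) : ℝ :=
  ∫ u in Ioi x, (1 - cdf ν u)

/-! ### The limit of the scaled time to sale -/

/-- The limiting CDF, `1 - (1 - s) ^ γ` on `[0, 1)`. -/
def limitCDF (γ s : ℝ) : ℝ :=
  if s < 0 then 0 else if s < 1 then 1 - (1 - s) ^ γ else 1

/-- `T_t / t` converges in distribution, as `t → ∞`, to the probability law with CDF
`limitCDF γ` (in the sense of weak convergence, and also with convergence of the CDFs at every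
point). -/
def HasScaledLimit {Ω : Type*} [MeasurableSpace Ω] (P : Measure Ω) [IsProbabilityMeasure P]
    (T : ℝ → Ω → ℝ) (γ : ℝ) : Prop :=
  (∀ s : ℝ, Tendsto (fun t : ℝ => P.real {ω | T t ω / t ≤ s}) atTop (𝓝 (limitCDF γ s))) ∧
  ∃ (L : Measure ℝ) (_ : IsProbabilityMeasure L), (∀ s : ℝ, cdf L s = limitCDF γ s) ∧
    TendstoInDistribution (fun (t : ℝ) ω => T t ω / t) atTop (id : ℝ → ℝ) (fun _ => P) L

/-- `E[T_t]/t = E[T_t/t] → m` and `Var[T_t]/t² = Var[T_t/t] → v` as `t → ∞`, where every `T_t` is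
square integrable. -/
def HasScaledMoments {Ω : Type*} [MeasurableSpace Ω] (P : Measure Ω)
    (T : ℝ → Ω → ℝ) (m v : ℝ) : Prop :=
  (∀ t : ℝ, 0 ≤ t → MemLp (T t) 2 P) ∧
  Tendsto (fun t : ℝ => (∫ ω, T t ω ∂P) / t) atTop (𝓝 m) ∧
  Tendsto (fun t : ℝ => ∫ ω, T t ω / t ∂P) atTop (𝓝 m) ∧
  Tendsto (fun t : ℝ => variance (T t) P / t ^ 2) atTop (𝓝 v) ∧
  Tendsto (fun t : ℝ => variance (fun ω => T t ω / t) P) atTop (𝓝 v)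

end CayleyMoser

end

/-!
Write `μ₀` for the mean of the residual price and `φ(x) = E (X - x)₊` for the expected excess of an
offer over `x`. The whole theorem is governed by the solution `m` of the Cayley–Moser equation
`m' = λ φ(m)`, `m(0) = μ₀` (`exists_isCayleyMoserSolution`).

*Optimality.* In integrated form the equation says that `m(r)` is the expectation, at the first
arrival from remaining time `r` on, of the better of accepting the offer and of going on with value
`m` (`IsCayleyMoserSolution.integral_bestReward`). So if a policy is followed until the `n`-th offer
and the continuation is then valued by `m`, the expected outcome is nonincreasing in `n`, and
constant for the threshold rule `x ≥ m(s)`. Letting `n → ∞` shows that no policy does better than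
`m(t)`, which the threshold rule attains (`integral_saleReward_le`,
`integral_saleReward_threshold`); thus `m` is the value function. A policy that attains `m(t)`
loses nothing at the first step, so it agrees with the threshold rule at almost every pair of
arrival time and offer. Ties `x = m(s)` do not matter, because `m` is injective and arrival times
have no atoms (`ae_mem_iff_of_isOptimalPolicy`).

*Law of the time to sale.* Under the threshold rule, offers are accepted at rate `λ (1 - F(m(s)))`
when the remaining time is `s`; this is `-(log φ(m(s)))'`, as `φ' = -(1 - F)` from the right.
Hence `P(T_t > u) = φ(m(t)) / φ(m(t - u))` for `0 ≤ u < t` (`measureReal_lt_timeToSale`). The proof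
runs the same one-step argument with `φ(m(r)) / φ(m(b))` in place of `m(r)`.

*Limits.* It remains to see that `φ ∘ m` is regularly varying of index `-γ`, since then
`P(T_t / t > s) → (1 - s) ^ γ`. With `Φ(x) = ∫_x^∞ φ`, the quantities `(M - m)^(-p)`, `1 / Φ(m)` and
`m² / Φ(m)`, in the three cases, have derivatives that converge, so they are asymptotically linear,
and this gives the regular variation (`tendsto_phi_ratio_bounded`, `tendsto_phi_ratio_exponential`,
`tendsto_phi_ratio_power`). The limit law is that of `1 - U ^ (1 / γ)` with `U` uniform, and the
moments converge because `T_t / t` takes values in `[0, 1]` (`hasScaledLimit_and_moments`).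
-/

namespace CayleyMoser

/-! ### The expected excess of an offer -/

lemma one_sub_cdf_eq (ν : Measure ℝ) [IsProbabilityMeasure ν] (u : ℝ) :
    1 - cdf ν u = ν.real (Ioi u) := by
  rw [cdf_eq_real, ← compl_Iic, probReal_compl_eq_one_sub measurableSet_Iic]

lemma antitone_one_sub_cdf (ν : Measure ℝ) : Antitone fun u => 1 - cdf ν u :=
  fun _ _ h => sub_le_sub_left (monotone_cdf ν h) 1

lemma integrable_posPart_sub {ν : Measure ℝ} [IsProbabilityMeasure ν]
    (hν : Integrable (fun x : ℝ => max x 0) ν) (s : ℝ) :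
    Integrable (fun x : ℝ => max (x - s) 0) ν := by
  refine (hν.add (integrable_const |s|)).mono' (by fun_prop) (ae_of_all _ fun x => ?_)
  rw [Real.norm_of_nonneg (le_max_right _ _)]
  refine max_le ?_ (by simp only [Pi.add_apply]; positivity)
  have := le_max_left x 0
  have := neg_abs_le s
  simp only [Pi.add_apply]
  linarith

lemma integrableOn_one_sub_cdf {ν : Measure ℝ} [IsProbabilityMeasure ν]
    (hν : Integrable (fun x : ℝ => max x 0) ν) (s : ℝ) :
    IntegrableOn (fun u => 1 - cdf ν u) (Ioi s) := by
  have hmeas : Measurable fun u => 1 - cdf ν u := (monotone_cdf ν).measurable.const_sub 1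
  have key : IntegrableOn (fun u => 1 - cdf ν u) (Ioi 0) := by
    refine ⟨hmeas.aestronglyMeasurable, ?_⟩
    have h := lintegral_eq_lintegral_meas_lt ν (f := fun x : ℝ => max x 0)
      (ae_of_all _ fun x => le_max_right _ _) (by fun_prop)
    have h2 : ∫⁻ u in Ioi 0, ‖1 - cdf ν u‖ₑ = ∫⁻ u in Ioi 0, ν {a | u < max a 0} := by
      refine setLIntegral_congr_fun measurableSet_Ioi fun u (hu : 0 < u) => ?_
      have : {a : ℝ | u < max a 0} = Ioi u := by
        ext a; simp [hu.not_gt]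
      rw [this, one_sub_cdf_eq, Real.enorm_of_nonneg measureReal_nonneg, ofReal_measureReal]
    rw [HasFiniteIntegral, h2, ← h]
    exact hν.lintegral_lt_top
  refine (key.union (((antitone_one_sub_cdf ν).locallyIntegrable.integrableOn_isCompact
    (isCompact_Icc (a := s) (b := 0))).mono_set Ioc_subset_Icc_self)).mono_set ?_
  intro u hu
  rcases lt_or_ge 0 u with h | h
  · exact Or.inl h
  · exact Or.inr ⟨hu, h⟩

/-- `φ(s)` is the expected excess of an offer over `s`. -/
lemma phi_eq_integral {ν : Measure ℝ} [IsProbabilityMeasure ν]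
    (hν : Integrable (fun x : ℝ => max x 0) ν) (s : ℝ) :
    phi ν s = ∫ x, max (x - s) 0 ∂ν := by
  rw [(integrable_posPart_sub hν s).integral_eq_integral_meas_lt
    (ae_of_all _ fun x => le_max_right _ _), phi]
  have h := (measurePreserving_add_right volume s).setIntegral_preimage_emb
    (measurableEmbedding_addRight s) (fun u => 1 - cdf ν u) (Ioi s)
  rw [preimage_add_const_Ioi, sub_self] at h
  rw [← h]
  refine setIntegral_congr_fun measurableSet_Ioi fun u (hu : 0 < u) => ?_
  simp only [one_sub_cdf_eq]
  congr 1
  ext a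
  simp [hu.not_gt, lt_sub_iff_add_lt]

lemma integral_max_eq_add_phi {ν : Measure ℝ} [IsProbabilityMeasure ν]
    (hν : Integrable (fun x : ℝ => max x 0) ν) (s : ℝ) :
    ∫ x, max x s ∂ν = s + phi ν s := by
  rw [phi_eq_integral hν]
  have : ∀ x : ℝ, max x s = s + max (x - s) 0 := fun x => by
    rw [← max_add_add_left]; simp
  simp_rw [this]
  rw [integral_add (integrable_const _) (integrable_posPart_sub hν s)]
  simp

lemma phi_eq_sub_intervalIntegral {ν : Measure ℝ} [IsProbabilityMeasure ν]
    (hν : Integrable (fun x : ℝ => max x 0) ν) (a x : ℝ) :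
    phi ν x = phi ν a - ∫ u in a..x, (1 - cdf ν u) := by
  rw [← intervalIntegral.integral_Ioi_sub_Ioi' (integrableOn_one_sub_cdf hν a)
    (integrableOn_one_sub_cdf hν x), phi, phi]
  ring

lemma antitone_phi {ν : Measure ℝ} [IsProbabilityMeasure ν]
    (hν : Integrable (fun x : ℝ => max x 0) ν) : Antitone (phi ν) := by
  intro a b hab
  rw [phi_eq_sub_intervalIntegral hν a b, sub_le_self_iff]
  exact intervalIntegral.integral_nonneg hab fun u _ => sub_nonneg.2 (cdf_le_one ν u)

lemma phi_nonneg (ν : Measure ℝ) (x : ℝ) : 0 ≤ phi ν x :=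
  setIntegral_nonneg measurableSet_Ioi fun u _ => sub_nonneg.2 (cdf_le_one ν u)

lemma continuous_phi {ν : Measure ℝ} [IsProbabilityMeasure ν]
    (hν : Integrable (fun x : ℝ => max x 0) ν) : Continuous (phi ν) := by
  have : phi ν = fun x => phi ν 0 - ∫ u in (0 : ℝ)..x, (1 - cdf ν u) := by
    ext x; exact phi_eq_sub_intervalIntegral hν 0 x
  rw [this]
  refine continuous_const.sub (intervalIntegral.continuous_primitive (fun a b => ?_) 0)
  exact (antitone_one_sub_cdf ν).intervalIntegrable

lemma hasDerivWithinAt_phi {ν : Measure ℝ} [IsProbabilityMeasure ν]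
    (hν : Integrable (fun x : ℝ => max x 0) ν) (x : ℝ) :
    HasDerivWithinAt (phi ν) (-(1 - cdf ν x)) (Ici x) x := by
  have : phi ν = fun y => phi ν x - ∫ u in x..y, (1 - cdf ν u) := by
    ext y; exact phi_eq_sub_intervalIntegral hν x y
  rw [this]
  refine HasDerivWithinAt.const_sub _ ?_
  refine intervalIntegral.integral_hasDerivWithinAt_right (by simp) (t := Ioi x) ?_ ?_
  · exact ((monotone_cdf ν).measurable.const_sub 1).stronglyMeasurable.stronglyMeasurableAtFilter
  · exact (continuousWithinAt_const.sub ((cdf ν).right_continuous x)).mono Ioi_subset_Ici_self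

lemma tendsto_phi_atTop {ν : Measure ℝ} [IsProbabilityMeasure ν]
    (hν : Integrable (fun x : ℝ => max x 0) ν) : Tendsto (phi ν) atTop (𝓝 0) := by
  have h := intervalIntegral_tendsto_integral_Ioi 0 (integrableOn_one_sub_cdf hν 0) tendsto_id
  have h2 : phi ν = fun x => phi ν 0 - ∫ u in (0 : ℝ)..x, (1 - cdf ν u) := by
    ext x; exact phi_eq_sub_intervalIntegral hν 0 x
  rw [h2]
  simpa [phi] using h.const_sub (phi ν 0)

/-- The excess `φ(x)` is positive exactly below the top of the support. -/
lemma phi_pos_iff {ν : Measure ℝ} [IsProbabilityMeasure ν]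
    (hν : Integrable (fun x : ℝ => max x 0) ν) (x : ℝ) :
    0 < phi ν x ↔ (x : EReal) < supportMax ν := by
  simp only [supportMax, lt_iSup_iff, mem_ofPred_eq, exists_prop, EReal.coe_lt_coe_iff]
  constructor
  · intro h
    by_contra! hc
    have : phi ν x = 0 := by
      rw [phi, setIntegral_eq_zero_of_forall_eq_zero]
      intro u (hu : x < u)
      have : 1 ≤ cdf ν u := by
        by_contra! h1
        exact (hc u h1).not_gt hu
      linarith [cdf_le_one ν u]
    exact h.ne' this
  · rintro ⟨y, hy, hxy⟩
    have h1 : (y - x) * (1 - cdf ν y) ≤ ∫ u in x..y, (1 - cdf ν u) := by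
      have := intervalIntegral.integral_mono_on hxy.le (μ := volume)
        (f := fun _ => 1 - cdf ν y) (g := fun u => 1 - cdf ν u) (by simp)
        (antitone_one_sub_cdf ν).intervalIntegrable
        (fun u hu => by linarith [monotone_cdf ν hu.2])
      rw [intervalIntegral.integral_const, smul_eq_mul] at this
      exact this
    have h2 := phi_eq_sub_intervalIntegral hν x y
    have h3 : 0 < (y - x) * (1 - cdf ν y) := mul_pos (by linarith) (by linarith)
    linarith [phi_nonneg ν y]

/-! ### The Cayley–Moser equation -/

/-- `m` solves the Cayley–Moser equation `m' = λ φ(m)`, `m(0) = μ₀` for nonnegative times. The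
values of `m` at negative times are immaterial; they are only required to make `m` a strictly
increasing bijection of `ℝ` onto the region `φ > 0` below the top of the support. -/
structure IsCayleyMoserSolution (lam : ℝ) (ν : Measure ℝ) (μ₀ : ℝ) (m : ℝ → ℝ) : Prop where
  zero : m 0 = μ₀
  strictMono : StrictMono m
  continuous : Continuous m
  hasDerivAt : ∀ t, 0 ≤ t → HasDerivAt m (lam * phi ν (m t)) t
  phi_pos : ∀ t, 0 < phi ν (m t)
  surj : ∀ x, 0 < phi ν x → ∃ t, m t = x

/-- The solution is the inverse function of the time `G(x) = ∫_{μ₀}^x du / (λ φ(u))` needed to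
climb from `μ₀` to `x`; below `μ₀` the integrand is frozen at its value at `μ₀`. This `G` is onto
because `-(log φ)' = (1 - F) / φ ≤ 1 / φ` and `φ` takes arbitrarily small positive values. -/
theorem exists_isCayleyMoserSolution {lam : ℝ} (hlam : 0 < lam) {ν : Measure ℝ}
    [IsProbabilityMeasure ν] (hν : Integrable (fun x : ℝ => max x 0) ν) {μ₀ : ℝ}
    (h0 : 0 < phi ν μ₀) : ∃ m, IsCayleyMoserSolution lam ν μ₀ m := by
  set I : Set ℝ := {x | 0 < phi ν x} with hI
  have hIopen : IsOpen I := isOpen_lt continuous_const (continuous_phi hν)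
  have hIlow : ∀ x ∈ I, ∀ y, y ≤ x → y ∈ I := fun x hx y hy =>
    lt_of_lt_of_le hx (antitone_phi hν hy)
  have hImax : ∀ x ∈ I, 0 < phi ν (max x μ₀) := fun x hx => by
    rcases max_choice x μ₀ with h | h <;> rw [h]
    exacts [hx, h0]
  set k : ℝ → ℝ := fun u => 1 / (lam * phi ν (max u μ₀)) with hk
  have hkpos : ∀ x ∈ I, 0 < k x := fun x hx => by
    have := hImax x hx
    simp only [hk]; positivity
  have hkc : ContinuousOn k I := by
    intro x hx
    have := (hImax x hx).ne'
    refine ContinuousAt.continuousWithinAt (ContinuousAt.div continuousAt_const ?_ ?_)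
    · exact ((continuous_const.mul ((continuous_phi hν).comp
        (continuous_id.max continuous_const)))).continuousAt
    · exact mul_ne_zero hlam.ne' this
  set G : ℝ → ℝ := fun x => ∫ u in μ₀..x, k u with hG
  have hGd : ∀ x ∈ I, HasDerivAt G (k x) x := by
    intro x hx
    refine intervalIntegral.integral_hasDerivAt_right ?_ ?_ (hkc.continuousAt (hIopen.mem_nhds hx))
    · refine (hkc.mono fun y hy => ?_).intervalIntegrable
      rcases max_choice μ₀ x with h | h
      · exact hIlow _ h0 y (by rw [← h]; exact hy.2)
      · exact hIlow _ hx y (by rw [← h]; exact hy.2)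
    · exact hkc.stronglyMeasurableAtFilter hIopen x hx
  have hGc : ContinuousOn G I := fun x hx => (hGd x hx).continuousAt.continuousWithinAt
  have hIconv : Convex ℝ I := by
    refine OrdConnected.convex ⟨fun x _ y hy z hz => hIlow y hy z hz.2⟩
  have hGmono : StrictMonoOn G I := by
    refine strictMonoOn_of_deriv_pos hIconv hGc fun x hx => ?_
    rw [hIopen.interior_eq] at hx
    rw [(hGd x hx).deriv]
    exact hkpos x hx
  have hG0 : G μ₀ = 0 := by simp [hG]
  have hlow : ∀ x ≤ μ₀, G x = (x - μ₀) / (lam * phi ν μ₀) := by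
    intro x hx
    have : ∫ u in μ₀..x, k u = ∫ u in μ₀..x, 1 / (lam * phi ν μ₀) := by
      refine intervalIntegral.integral_congr fun u hu => ?_
      rw [uIcc_of_ge hx] at hu
      simp only [hk, max_eq_right hu.2]
    simp only [hG]
    rw [this, intervalIntegral.integral_const, smul_eq_mul]
    ring
  have hup : ∀ x ∈ I, μ₀ ≤ x → (Real.log (phi ν μ₀) - Real.log (phi ν x)) / lam ≤ G x := by
    intro x hx hx0
    have hmem : ∀ y ∈ Icc μ₀ x, y ∈ I := fun y hy => hIlow x hx y hy.2
    refine image_le_of_deriv_right_le_deriv_boundary (a := μ₀) (b := x)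
      (f := fun y => (Real.log (phi ν μ₀) - Real.log (phi ν y)) / lam)
      (f' := fun y => (1 - cdf ν y) / phi ν y / lam) (B := G) (B' := k) ?_ ?_ ?_
      (hGc.mono hmem) ?_ ?_ (right_mem_Icc.2 hx0)
    · exact (continuousOn_const.sub ((continuous_phi hν).continuousOn.log
        fun y hy => (hmem y hy).ne')).div_const _
    · intro y hy
      have := ((hasDerivWithinAt_phi hν y).log (hmem y (Ico_subset_Icc_self hy)).ne').const_sub
        (Real.log (phi ν μ₀)) |>.div_const lam
      exact this.congr_deriv (by ring)
    · simp [hG0]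
    · exact fun y hy => (hGd y (hmem y (Ico_subset_Icc_self hy))).hasDerivWithinAt
    · intro y hy
      have hp : 0 < phi ν y := hmem y (Ico_subset_Icc_self hy)
      simp only [hk, max_eq_left hy.1]
      rw [div_div, mul_comm lam]
      gcongr
      linarith [cdf_nonneg ν y]
  have hsurj : ∀ T, ∃ x ∈ I, G x = T := by
    intro T
    have h1 : ∃ x ∈ I, G x ≤ T := by
      refine ⟨min μ₀ (μ₀ + lam * phi ν μ₀ * T), hIlow μ₀ h0 _ (min_le_left _ _), ?_⟩
      rw [hlow _ (min_le_left _ _), div_le_iff₀ (by positivity)]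
      linarith [min_le_right μ₀ (μ₀ + lam * phi ν μ₀ * T)]
    have h2 : ∃ x ∈ I, T ≤ G x := by
      -- at the point where `φ` has dropped to `φ(μ₀) exp(-λ |T|)`, the time is at least `|T|`
      have hε : 0 < phi ν μ₀ * Real.exp (-(lam * |T|)) := by positivity
      obtain ⟨y, hy, hy0⟩ := (((tendsto_phi_atTop hν).eventually (gt_mem_nhds hε)).and
        (eventually_ge_atTop μ₀)).exists
      obtain ⟨x, hx, hxe⟩ := intermediate_value_Icc' hy0 (continuous_phi hν).continuousOn
        ⟨hy.le, mul_le_of_le_one_right h0.le (Real.exp_le_one_iff.2 (by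
          have := abs_nonneg T
          simp only [Left.neg_nonpos_iff]; positivity))⟩
      have hxI : x ∈ I := by rw [hI, mem_ofPred_eq, hxe]; exact hε
      refine ⟨x, hxI, le_trans ?_ (hup x hxI hx.1)⟩
      rw [hxe, Real.log_mul h0.ne' (Real.exp_pos _).ne', Real.log_exp, le_div_iff₀ hlam]
      nlinarith [le_abs_self T]
    obtain ⟨a, ha, haT⟩ := h1
    obtain ⟨b, hb, hbT⟩ := h2
    exact hIconv.isPreconnected.intermediate_value ha hb hGc ⟨haT, hbT⟩
  choose m hmI hmG using hsurj
  have hmono : StrictMono m := fun a b hab => by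
    by_contra! hc
    have := hGmono.monotoneOn (hmI b) (hmI a) hc
    rw [hmG, hmG] at this
    exact this.not_gt hab
  have hleft : ∀ x ∈ I, m (G x) = x := fun x hx => hGmono.injOn (hmI _) hx (hmG _)
  have hcont : Continuous m := continuous_iff_continuousAt.2 fun a =>
    continuousAt_of_monotoneOn_of_image_mem_nhds (hmono.monotone.monotoneOn univ) univ_mem
      (mem_of_superset (hIopen.mem_nhds (hmI a)) fun x hx => ⟨G x, mem_univ _, hleft x hx⟩)
  have hm0 : m 0 = μ₀ := by rw [← hG0]; exact hleft μ₀ h0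
  refine ⟨m, hm0, hmono, hcont, fun t ht => ?_, hmI, fun x hx => ⟨G x, hleft x hx⟩⟩
  have h := HasDerivAt.of_local_left_inverse hcont.continuousAt (hGd _ (hmI t))
    (hkpos _ (hmI t)).ne' (Eventually.of_forall hmG)
  have hge : μ₀ ≤ m t := hm0 ▸ hmono.monotone ht
  exact h.congr_deriv (by simp [hk, max_eq_left hge])

namespace IsCayleyMoserSolution

variable {lam : ℝ} {ν : Measure ℝ} {μ₀ : ℝ} {m : ℝ → ℝ}

lemma le_of_nonneg (h : IsCayleyMoserSolution lam ν μ₀ m) {t : ℝ} (ht : 0 ≤ t) : μ₀ ≤ m t :=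
  h.zero ▸ h.strictMono.monotone ht

/-- The right derivative of `φ(m(t)) = m'(t) / λ`: it decreases at rate `λ (1 - F(m(t)))`. -/
lemma hasDerivWithinAt_phi_comp [IsProbabilityMeasure ν]
    (hν : Integrable (fun x : ℝ => max x 0) ν)
    (h : IsCayleyMoserSolution lam ν μ₀ m) {t : ℝ} (ht : 0 ≤ t) :
    HasDerivWithinAt (fun s => phi ν (m s)) (-(1 - cdf ν (m t)) * (lam * phi ν (m t))) (Ici t) t :=
  (hasDerivWithinAt_phi hν (m t)).comp t (h.hasDerivAt t ht).hasDerivWithinAt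
    fun _ hs => h.strictMono.monotone hs

end IsCayleyMoserSolution

/-! ### Exponential waiting times -/

lemma expMeasure_Iic_zero {lam : ℝ} (hlam : 0 < lam) : expMeasure lam (Iic 0) = 0 := by
  have := isProbabilityMeasure_expMeasure hlam
  have h := cdf_expMeasure_eq hlam 0
  rw [cdf_eq_real] at h
  simpa [measureReal_eq_zero_iff] using h

lemma expMeasure_absolutelyContinuous (lam : ℝ) : expMeasure lam ≪ volume :=
  withDensity_absolutelyContinuous _ _

lemma integral_expMeasure {lam : ℝ} (hlam : 0 < lam) (f : ℝ → ℝ) :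
    ∫ d, f d ∂(expMeasure lam) = ∫ d in Ioi 0, lam * Real.exp (-(lam * d)) * f d := by
  have h : ∫ d, f d ∂(expMeasure lam) = ∫ d, (exponentialPDF lam d).toReal • f d :=
    integral_withDensity_eq_integral_toReal_smul (measurable_exponentialPDFReal lam).ennreal_ofReal
      (ae_of_all _ fun _ => ENNReal.ofReal_lt_top) f
  rw [h, ← integral_Ici_eq_integral_Ioi, ← integral_indicator measurableSet_Ici]
  congr 1
  ext d
  by_cases hd : 0 ≤ d
  · rw [indicator_of_mem (mem_Ici.2 hd), exponentialPDF_of_nonneg hd,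
      ENNReal.toReal_ofReal (by positivity), smul_eq_mul]
  · rw [indicator_of_notMem (by simpa using hd), exponentialPDF_of_neg (not_le.1 hd)]
    simp

lemma expMeasure_real_Ici {lam : ℝ} (hlam : 0 < lam) {a : ℝ} (ha : 0 ≤ a) :
    (expMeasure lam).real (Ici a) = Real.exp (-(lam * a)) := by
  have := isProbabilityMeasure_expMeasure hlam
  have h := cdf_expMeasure_eq hlam a
  rw [cdf_eq_real, if_pos ha] at h
  have h2 : (expMeasure lam).real (Ici a) = (expMeasure lam).real (Ioi a) := by
    rw [measureReal_def, measureReal_def, measure_congr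
      ((expMeasure_absolutelyContinuous lam).ae_eq Ioi_ae_eq_Ici)]
  rw [h2, ← compl_Iic, probReal_compl_eq_one_sub measurableSet_Iic, h]
  ring

/-- The renewal equation at the first exponential time `d`, in differential form: if
`h' = λ (h̃ - k)`, with a right derivative, then `h(r)` is the expectation of `k(r - d)` on
`r - d > b` and of `h(b)` otherwise. -/
lemma integral_expMeasure_step {lam : ℝ} (hlam : 0 < lam) {h k : ℝ → ℝ} {b r : ℝ} (hbr : b ≤ r)
    (hc : ContinuousOn h (Icc b r))
    (hd : ∀ s ∈ Ioo b r, HasDerivWithinAt h (lam * (k s - h s)) (Ioi s) s)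
    (hk : IntervalIntegrable k volume b r) :
    ∫ d, (if d < r - b then k (r - d) else h b) ∂(expMeasure lam) = h r := by
  have := isProbabilityMeasure_expMeasure hlam
  have hrb : 0 ≤ r - b := sub_nonneg.2 hbr
  have hexp : Continuous fun s => lam * Real.exp (lam * s) := by fun_prop
  have hint : IntervalIntegrable (fun s => lam * Real.exp (lam * s) * k s) volume b r :=
    hk.continuousOn_mul hexp.continuousOn
  -- `exp (λ s) h(s)` has right derivative `λ exp (λ s) k(s)`
  have hftc : ∫ s in b..r, lam * Real.exp (lam * s) * k s
      = Real.exp (lam * r) * h r - Real.exp (lam * b) * h b := by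
    refine intervalIntegral.integral_eq_sub_of_hasDeriv_right_of_le hbr
      (f := fun s => Real.exp (lam * s) * h s) (ContinuousOn.mul (by fun_prop) hc) ?_ hint
    intro s hs
    have h1 : HasDerivAt (fun s => Real.exp (lam * s)) (Real.exp (lam * s) * lam) s := by
      simpa using ((hasDerivAt_id s).const_mul lam).exp
    exact (h1.hasDerivWithinAt.mul (hd s hs)).congr_deriv (by ring)
  have hsub : ∫ d in (0 : ℝ)..(r - b), lam * Real.exp (-(lam * d)) * k (r - d)
      = Real.exp (-(lam * r)) * ∫ s in b..r, lam * Real.exp (lam * s) * k s := by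
    have := intervalIntegral.integral_comp_sub_left (a := 0) (b := r - b)
      (fun s => lam * Real.exp (lam * (s - r)) * k s) r
    simp only [sub_zero, sub_sub_cancel] at this
    rw [← intervalIntegral.integral_const_mul]
    convert this using 1
    · refine intervalIntegral.integral_congr fun d _ => ?_
      congr 3
      ring
    · refine intervalIntegral.integral_congr fun s _ => ?_
      rw [mul_sub, sub_eq_add_neg, Real.exp_add]
      ring
  have hi1 : Integrable (fun d => lam * Real.exp (-(lam * d)) * k (r - d))
      (volume.restrict (Ioc 0 (r - b))) := by
    have h1 := (hk.comp_sub_left r).symm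
    simp only [sub_self] at h1
    have h2 : IntervalIntegrable (fun d => lam * Real.exp (-(lam * d)) * k (r - d)) volume 0
        (r - b) := h1.continuousOn_mul (by fun_prop)
    exact (intervalIntegrable_iff_integrableOn_Ioc_of_le hrb).1 h2
  have hsplit : ∫ d, (if d < r - b then k (r - d) else h b) ∂(expMeasure lam)
      = (∫ d in (0 : ℝ)..(r - b), lam * Real.exp (-(lam * d)) * k (r - d))
        + Real.exp (-(lam * (r - b))) * h b := by
    have e1 : ∫ d, (Ici (r - b)).indicator (fun _ => h b) d ∂(expMeasure lam)
        = Real.exp (-(lam * (r - b))) * h b := by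
      rw [integral_indicator_const _ measurableSet_Ici, expMeasure_real_Ici hlam hrb, smul_eq_mul]
    rw [← e1, integral_expMeasure hlam, integral_expMeasure hlam,
      intervalIntegral.integral_of_le hrb, integral_Ioc_eq_integral_Ioo, ← Ioi_inter_Iio,
      ← setIntegral_indicator measurableSet_Iio, ← integral_add]
    · congr 1
      ext d
      by_cases hdr : d < r - b
      · rw [if_pos hdr, indicator_of_mem (mem_Iio.2 hdr), indicator_of_notMem (notMem_Ici.2 hdr)]
        ring
      · rw [if_neg hdr, indicator_of_notMem (by simpa using hdr),
          indicator_of_mem (by simpa using hdr)]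
        ring
    · rw [integrable_indicator_iff measurableSet_Iio, IntegrableOn,
        Measure.restrict_restrict measurableSet_Iio, inter_comm, Ioi_inter_Iio]
      exact IntegrableOn.mono_set hi1 Ioo_subset_Ioc_self
    · have h3 : IntegrableOn (fun d => lam * Real.exp (-(lam * d))) (Ioi 0) := by
        have := (exp_neg_integrableOn_Ioi 0 hlam).const_mul lam
        simpa only [neg_mul, IntegrableOn] using this
      have h4 := (h3.mul_const (h b)).indicator (measurableSet_Ici (a := r - b))
      refine h4.congr (ae_of_all _ fun d => ?_)
      by_cases hdr : d ∈ Ici (r - b) <;> simp [hdr, indicator]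
  rw [hsplit, hsub, hftc, mul_sub, ← mul_assoc, ← mul_assoc, ← Real.exp_add, ← Real.exp_add]
  have e2 : -(lam * (r - b)) = -(lam * r) + lam * b := by ring
  rw [e2]
  simp

/-! ### Paths of the bidding process and their one-step analysis -/

section Paths

variable {Ω : Type*} {D X : ℕ → Ω → ℝ} {A : Set (ℝ × ℝ)} {t : ℝ} {ω : Ω}

lemma remaining_nonneg (ht : 0 ≤ t) (n : ℕ) (ω : Ω) : 0 ≤ remaining D t n ω := by
  cases n with
  | zero => exact ht
  | succ n => exact le_max_right _ _

lemma remaining_le (ht : 0 ≤ t) (hD : ∀ n, 0 ≤ D n ω) (n : ℕ) : remaining D t n ω ≤ t := by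
  induction n with
  | zero => exact le_rfl
  | succ n ih => exact max_le (by linarith [hD n]) ht

lemma remaining_succ_eq_zero (ht : 0 ≤ t) (hD : ∀ n, 0 ≤ D n ω) {n : ℕ} (hn : t ≤ D n ω) :
    remaining D t (n + 1) ω = 0 :=
  max_eq_right (by linarith [remaining_le ht hD n])

variable (D X A t) in
/-- The event that the process has not ended before the arrival of the offer `X n`. -/
def alive (n : ℕ) : Set Ω :=
  {ω | ∀ k < n, ¬ (remaining D t (k + 1) ω = 0 ∨ (remaining D t (k + 1) ω, X k ω) ∈ A)}

lemma alive_zero : alive D X A t 0 = univ := by simp [alive]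

lemma mem_alive_succ {n : ℕ} : ω ∈ alive D X A t (n + 1) ↔ ω ∈ alive D X A t n ∧
    ¬ (remaining D t (n + 1) ω = 0 ∨ (remaining D t (n + 1) ω, X n ω) ∈ A) := by
  simp only [alive, mem_ofPred_eq, Order.lt_add_one_iff]
  constructor
  · exact fun h => ⟨fun k hk => h k hk.le, h n le_rfl⟩
  · rintro ⟨h, hn⟩ k hk
    rcases hk.lt_or_eq with hk | rfl
    exacts [h k hk, hn]

lemma stopIndex_eq {n : ℕ} (h : ω ∈ alive D X A t n) (h' : ω ∉ alive D X A t (n + 1)) :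
    stopIndex D X A t ω = n := by
  rw [mem_alive_succ] at h'
  have hn : remaining D t (n + 1) ω = 0 ∨ (remaining D t (n + 1) ω, X n ω) ∈ A := by tauto
  refine le_antisymm (Nat.sInf_le hn) ?_
  by_contra! hlt
  exact h _ hlt (Nat.sInf_mem (s := {n : ℕ | remaining D t (n + 1) ω = 0 ∨
    (remaining D t (n + 1) ω, X n ω) ∈ A}) ⟨n, hn⟩)

lemma stopIndex_spec (h : ∃ n, remaining D t (n + 1) ω = 0) :
    remaining D t (stopIndex D X A t ω + 1) ω = 0 ∨
      (remaining D t (stopIndex D X A t ω + 1) ω, X (stopIndex D X A t ω) ω) ∈ A :=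
  Nat.sInf_mem (s := {n : ℕ | remaining D t (n + 1) ω = 0 ∨
    (remaining D t (n + 1) ω, X n ω) ∈ A}) (h.imp fun _ hn => Or.inl hn)

lemma notMem_alive_of_lt (h : ∃ n, remaining D t (n + 1) ω = 0) {n : ℕ}
    (hn : stopIndex D X A t ω < n) : ω ∉ alive D X A t n :=
  fun ha => ha _ hn (stopIndex_spec h)

lemma measurable_remaining [MeasurableSpace Ω] {n : ℕ} (hD : ∀ k < n, Measurable (D k)) :
    Measurable (remaining D t n) := by
  induction n with
  | zero => exact measurable_const
  | succ n ih =>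
    exact ((ih fun k hk => hD k (by omega)).sub (hD n (by omega))).max measurable_const

lemma measurableSet_ended [MeasurableSpace Ω] (hA : MeasurableSet A) {n : ℕ}
    (hD : ∀ k < n + 1, Measurable (D k)) (hX : Measurable (X n)) :
    MeasurableSet {ω | remaining D t (n + 1) ω = 0 ∨ (remaining D t (n + 1) ω, X n ω) ∈ A} :=
  (measurableSet_eq_fun (measurable_remaining hD) measurable_const).union
    (((measurable_remaining hD).prodMk hX) hA)

lemma measurableSet_alive [MeasurableSpace Ω] (hA : MeasurableSet A) {n : ℕ}
    (hD : ∀ k < n, Measurable (D k)) (hX : ∀ k < n, Measurable (X k)) :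
    MeasurableSet (alive D X A t n) := by
  have : alive D X A t n = ⋂ k ∈ Finset.range n,
      {ω | remaining D t (k + 1) ω = 0 ∨ (remaining D t (k + 1) ω, X k ω) ∈ A}ᶜ := by
    ext ω; simp [alive]
  rw [this]
  refine Finset.measurableSet_biInter _ fun k hk => ?_
  rw [Finset.mem_range] at hk
  exact (measurableSet_ended hA (fun j hj => hD j (by omega)) (hX k hk)).compl

lemma measurable_stopIndex [MeasurableSpace Ω] (hA : MeasurableSet A) (hD : ∀ k, Measurable (D k))
    (hX : ∀ k, Measurable (X k)) : Measurable (stopIndex D X A t) := by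
  have hp : ∀ n, MeasurableSet
      {ω | remaining D t (n + 1) ω = 0 ∨ (remaining D t (n + 1) ω, X n ω) ∈ A} :=
    fun n => measurableSet_ended hA (fun k _ => hD k) (hX n)
  have hal : ∀ n, MeasurableSet (alive D X A t n) := fun n =>
    measurableSet_alive hA (fun k _ => hD k) fun k _ => hX k
  refine measurable_to_countable' fun n => ?_
  -- the junk value `sInf ∅ = 0` is taken on the event that the process never ends
  have : stopIndex D X A t ⁻¹' {n} = (alive D X A t n \ alive D X A t (n + 1)) ∪
      (if n = 0 then ⋂ k, alive D X A t k else ∅) := by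
    ext ω
    simp only [mem_preimage, mem_singleton_iff, mem_union, Set.mem_sdiff]
    by_cases hω : ∀ k, ω ∈ alive D X A t k
    · have h0 : stopIndex D X A t ω = 0 := by
        have : {n : ℕ | remaining D t (n + 1) ω = 0 ∨ (remaining D t (n + 1) ω, X n ω) ∈ A} = ∅ :=
          eq_empty_of_forall_notMem fun n hn => hω (n + 1) n (by omega) hn
        rw [stopIndex, this, Nat.sInf_empty]
      rw [h0]
      by_cases hn : n = 0
      · simp [hn, hω]
      · simp [hn, hω, Ne.symm hn]
    · have hinf : ω ∉ (if n = 0 then ⋂ k, alive D X A t k else ∅) := by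
        split_ifs <;> simp
        simpa using hω
      simp only [hinf, or_false]
      refine ⟨fun h => ?_, fun h => stopIndex_eq h.1 h.2⟩
      obtain ⟨j, hj, hj'⟩ : ∃ j, ω ∈ alive D X A t j ∧ ω ∉ alive D X A t (j + 1) := by
        by_contra! hc
        refine hω fun k => ?_
        induction k with
        | zero => simp [alive_zero]
        | succ k ih => exact hc k ih
      rw [← h, stopIndex_eq hj hj']
      exact ⟨hj, hj'⟩
  rw [this]
  refine ((hal n).diff (hal (n + 1))).union ?_
  split_ifs
  exacts [MeasurableSet.iInter hal, MeasurableSet.empty]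

lemma measurable_comp_stopIndex [MeasurableSpace Ω] (hA : MeasurableSet A)
    (hD : ∀ k, Measurable (D k)) (hX : ∀ k, Measurable (X k)) {Y : ℕ → Ω → ℝ}
    (hY : ∀ k, Measurable (Y k)) : Measurable fun ω => Y (stopIndex D X A t ω) ω := by
  have h : Measurable fun p : ℕ × Ω => Y p.1 p.2 := measurable_from_prod_countable_right hY
  exact h.comp ((measurable_stopIndex hA hD hX).prodMk measurable_id)

lemma measurable_remaining_stopIndex [MeasurableSpace Ω] (hA : MeasurableSet A)
    (hD : ∀ k, Measurable (D k)) (hX : ∀ k, Measurable (X k)) :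
    Measurable fun ω => remaining D t (stopIndex D X A t ω + 1) ω :=
  measurable_comp_stopIndex hA hD hX (Y := fun n => remaining D t (n + 1))
    fun _ => measurable_remaining fun k _ => hD k

lemma measurable_timeToSale [MeasurableSpace Ω] (hA : MeasurableSet A)
    (hD : ∀ k, Measurable (D k)) (hX : ∀ k, Measurable (X k)) :
    Measurable (timeToSale D X A t) :=
  (measurable_remaining_stopIndex hA hD hX).const_sub t

variable (D X A t) in
open Classical in
/-- The outcome of following the policy `A` until the arrival of the `n`-th offer: the reward
`f(t_i, X_i)` if the process has ended before, and the continuation value `h(t_n)` otherwise. -/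
noncomputable def stopped (f : ℝ × ℝ → ℝ) (h : ℝ → ℝ) (n : ℕ) (ω : Ω) : ℝ :=
  if ω ∈ alive D X A t n then h (remaining D t n ω)
  else f (remaining D t (stopIndex D X A t ω + 1) ω, X (stopIndex D X A t ω) ω)

variable (A) in
open Classical in
/-- The value of an offer `x` arriving at remaining time `r`, for the policy `A`: the reward
`f(r, x)` if the process ends there, the continuation value `h(r)` otherwise. -/
noncomputable def stepValue (f : ℝ × ℝ → ℝ) (h : ℝ → ℝ) (q : ℝ × ℝ) : ℝ :=
  if q.1 = 0 ∨ q ∈ A then f q else h q.1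

lemma stopped_zero (f : ℝ × ℝ → ℝ) (h : ℝ → ℝ) (ω : Ω) : stopped D X A t f h 0 ω = h t := by
  simp [stopped, alive_zero, remaining]

lemma stopped_succ (f : ℝ × ℝ → ℝ) (h : ℝ → ℝ) (n : ℕ) (ω : Ω) :
    stopped D X A t f h (n + 1) ω = stopped D X A t f h n ω + (alive D X A t n).indicator
      (fun ω => stepValue A f h (remaining D t (n + 1) ω, X n ω) - h (remaining D t n ω)) ω := by
  by_cases hn : ω ∈ alive D X A t n
  · by_cases hn' : ω ∈ alive D X A t (n + 1)
    · have := (mem_alive_succ.1 hn').2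
      simp [stopped, hn, hn', stepValue, this]
    · have h1 := stopIndex_eq hn hn'
      have h2 : remaining D t (n + 1) ω = 0 ∨ (remaining D t (n + 1) ω, X n ω) ∈ A := by
        rw [mem_alive_succ] at hn'; tauto
      simp [stopped, hn, hn', stepValue, h1, h2]
  · have hn' : ω ∉ alive D X A t (n + 1) := fun h => hn (mem_alive_succ.1 h).1
    simp [stopped, hn, hn']

lemma measurable_stopped [MeasurableSpace Ω] (hA : MeasurableSet A)
    (hD : ∀ k, Measurable (D k)) (hX : ∀ k, Measurable (X k)) {f : ℝ × ℝ → ℝ} {h : ℝ → ℝ}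
    (hf : Measurable f) (hh : Measurable h) (n : ℕ) : Measurable (stopped D X A t f h n) :=
  Measurable.ite (measurableSet_alive hA (fun k _ => hD k) fun k _ => hX k)
    (hh.comp (measurable_remaining fun k _ => hD k))
    (hf.comp ((measurable_remaining_stopIndex hA hD hX).prodMk
      (measurable_comp_stopIndex hA hD hX hX)))

lemma measurable_stepValue (hA : MeasurableSet A) {f : ℝ × ℝ → ℝ} {h : ℝ → ℝ}
    (hf : Measurable f) (hh : Measurable h) : Measurable (stepValue A f h) :=
  Measurable.ite ((measurableSet_eq_fun measurable_fst measurable_const).union hA) hf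
    (hh.comp measurable_fst)

end Paths

namespace IsBiddingProcess

lemma measurable_iSup_comap {Ω : Type*} (D X : ℕ → Ω → ℝ) (X₀ : Ω → ℝ) {S : Set (ℕ ⊕ ℕ ⊕ Unit)}
    {i : ℕ ⊕ ℕ ⊕ Unit} (hi : i ∈ S) :
    Measurable[⨆ i ∈ S, MeasurableSpace.comap
      (Sum.elim D (Sum.elim X (fun _ : Unit => X₀)) i) inferInstance]
      (Sum.elim D (Sum.elim X (fun _ : Unit => X₀)) i) :=
  Measurable.mono (comap_measurable _) (le_iSup₂_of_le i hi le_rfl) le_rfl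

variable {Ω : Type*} [mΩ : MeasurableSpace Ω] {P : Measure Ω} {lam : ℝ}
  {ν ν₀ : Measure ℝ} {D X : ℕ → Ω → ℝ} {X₀ : Ω → ℝ} {A : Set (ℝ × ℝ)} {t : ℝ}

/-- Random variables built from disjoint parts of the data are independent. -/
lemma indepFun_of_disjoint (hp : IsBiddingProcess P lam ν ν₀ D X X₀) {S T : Set (ℕ ⊕ ℕ ⊕ Unit)}
    (hST : Disjoint S T) {β γ : Type*} [mβ : MeasurableSpace β] [mγ : MeasurableSpace γ]
    {f : Ω → β} {g : Ω → γ}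
    (hf : Measurable[⨆ i ∈ S, MeasurableSpace.comap
      (Sum.elim D (Sum.elim X (fun _ : Unit => X₀)) i) inferInstance] f)
    (hg : Measurable[⨆ i ∈ T, MeasurableSpace.comap
      (Sum.elim D (Sum.elim X (fun _ : Unit => X₀)) i) inferInstance] g) : IndepFun f g P := by
  rw [IndepFun_iff_Indep]
  have hle : ∀ i, MeasurableSpace.comap
      (Sum.elim D (Sum.elim X (fun _ : Unit => X₀)) i) inferInstance ≤ mΩ := by
    rintro (n | n | n)
    exacts [(hp.measurable_D n).comap_le, (hp.measurable_X n).comap_le, hp.measurable_X₀.comap_le]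
  exact indep_of_indep_of_le_left (indep_of_indep_of_le_right
    (indep_iSup_of_disjoint hle hp.indep hST) hg.comap_le) hf.comap_le

lemma map_pair [IsProbabilityMeasure P]
    (hp : IsBiddingProcess P lam ν ν₀ D X X₀) (n : ℕ) :
    P.map (fun ω => (D n ω, X n ω)) = (expMeasure lam).prod ν := by
  have h : IndepFun (D n) (X n) P := hp.indepFun_of_disjoint
    (S := {Sum.inl n}) (T := {Sum.inr (Sum.inl n)}) (by simp)
    (measurable_iSup_comap D X X₀ (mem_singleton _))
    (measurable_iSup_comap D X X₀ (mem_singleton _))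
  rw [(indepFun_iff_map_prod_eq_prod_map_map (hp.measurable_D n).aemeasurable
    (hp.measurable_X n).aemeasurable).1 h, hp.law_D, hp.law_X]

lemma ae_pos (hp : IsBiddingProcess P lam ν ν₀ D X X₀) (hlam : 0 < lam) :
    ∀ᵐ ω ∂P, ∀ n, 0 < D n ω := by
  refine ae_all_iff.2 fun n => ?_
  have h := expMeasure_Iic_zero hlam
  rw [← hp.law_D n, Measure.map_apply (hp.measurable_D n) measurableSet_Iic] at h
  filter_upwards [measure_eq_zero_iff_ae_notMem.1 h] with ω hω
  simpa using hω

/-- Almost surely some inter-arrival time exceeds `t`, so the deadline is reached. -/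
lemma ae_exists_remaining_eq_zero [IsProbabilityMeasure P]
    (hp : IsBiddingProcess P lam ν ν₀ D X X₀) (hlam : 0 < lam)
    (ht : 0 ≤ t) : ∀ᵐ ω ∂P, ∃ n, remaining D t (n + 1) ω = 0 := by
  have := isProbabilityMeasure_expMeasure hlam
  have hind : iIndepFun D P := hp.indep.precomp (g := Sum.inl) Sum.inl_injective
  set p := expMeasure lam (Iio t) with hpdef
  have hp1 : p < 1 := by
    have h1 := expMeasure_real_Ici hlam ht
    rw [← compl_Iio, probReal_compl_eq_one_sub measurableSet_Iio] at h1
    have h2 : (expMeasure lam).real (Iio t) < 1 := by linarith [Real.exp_pos (-(lam * t))]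
    rw [hpdef, ← ofReal_measureReal]
    exact ENNReal.ofReal_lt_one.2 h2
  have hle : ∀ n, P (⋂ k, D k ⁻¹' Iio t) ≤ p ^ n := by
    intro n
    calc P (⋂ k, D k ⁻¹' Iio t) ≤ P (⋂ k ∈ Finset.range n, D k ⁻¹' Iio t) :=
          measure_mono (subset_iInter₂ fun k _ => iInter_subset _ k)
      _ = ∏ k ∈ Finset.range n, P (D k ⁻¹' Iio t) :=
          hind.measure_inter_preimage_eq_mul _ fun _ _ => measurableSet_Iio
      _ = p ^ n := by
          rw [Finset.prod_congr rfl fun k _ => ?_, Finset.prod_const, Finset.card_range]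
          rw [hpdef, ← hp.law_D k, Measure.map_apply (hp.measurable_D k) measurableSet_Iio]
  have h0 : P (⋂ k, D k ⁻¹' Iio t) = 0 := le_antisymm
    (ge_of_tendsto' (ENNReal.tendsto_pow_atTop_nhds_zero_of_lt_one hp1) hle) bot_le
  filter_upwards [measure_eq_zero_iff_ae_notMem.1 h0, hp.ae_pos hlam] with ω hω hpos
  simp only [mem_iInter, mem_preimage, mem_Iio, not_forall, not_lt] at hω
  exact hω.imp fun n hn => remaining_succ_eq_zero ht (fun k => (hpos k).le) hn

/-- One step of the process: the pair `(D n, X n)` is independent of the past, so a function of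
the remaining time and of this pair that is centred in the latter has integral `0` on the event
that the process has not ended. -/
lemma setIntegral_alive_eq_zero [IsProbabilityMeasure P] [IsProbabilityMeasure ν]
    (hp : IsBiddingProcess P lam ν ν₀ D X X₀)
    (hlam : 0 < lam) (ht : 0 ≤ t) (hA : MeasurableSet A) {J : ℝ × ℝ × ℝ → ℝ} (hJ : Measurable J)
    (hJ0 : ∀ r, 0 ≤ r → ∫ v, J (r, v) ∂((expMeasure lam).prod ν) = 0) (n : ℕ)
    (hint : Integrable (fun ω => J (remaining D t n ω, D n ω, X n ω)) P) :
    ∫ ω in alive D X A t n, J (remaining D t n ω, D n ω, X n ω) ∂P = 0 := by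
  have := isProbabilityMeasure_expMeasure hlam
  have hal : MeasurableSet (alive D X A t n) :=
    measurableSet_alive hA (fun k _ => hp.measurable_D k) fun k _ => hp.measurable_X k
  set U : Ω → ℝ × ℝ := fun ω => ((alive D X A t n).indicator (fun _ => 1) ω, remaining D t n ω)
  set V : Ω → ℝ × ℝ := fun ω => (D n ω, X n ω)
  set F : (ℝ × ℝ) × (ℝ × ℝ) → ℝ := fun p => p.1.1 * J (p.1.2, p.2) with hF
  have hFm : Measurable F := by fun_prop
  have hUm : Measurable U := (measurable_const.indicator hal).prodMk
    (measurable_remaining fun k _ => hp.measurable_D k)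
  have hVm : Measurable V := (hp.measurable_D n).prodMk (hp.measurable_X n)
  -- the data on which the past `U` and the next arrival `V` depend
  set S : Set (ℕ ⊕ ℕ ⊕ Unit) := Sum.inl '' Iio n ∪ (Sum.inr ∘ Sum.inl) '' Iio n
  set T : Set (ℕ ⊕ ℕ ⊕ Unit) := {Sum.inl n, Sum.inr (Sum.inl n)}
  have hUV : IndepFun U V P := by
    have hD' : ∀ k < n, Measurable[⨆ i ∈ S, MeasurableSpace.comap
      (Sum.elim D (Sum.elim X (fun _ : Unit => X₀)) i) inferInstance] (D k) := fun k hk =>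
        measurable_iSup_comap D X X₀ (i := Sum.inl k) (Or.inl ⟨k, hk, rfl⟩)
    have hX' : ∀ k < n, Measurable[⨆ i ∈ S, MeasurableSpace.comap
      (Sum.elim D (Sum.elim X (fun _ : Unit => X₀)) i) inferInstance] (X k) := fun k hk =>
        measurable_iSup_comap D X X₀ (i := Sum.inr (Sum.inl k)) (Or.inr ⟨k, hk, rfl⟩)
    refine hp.indepFun_of_disjoint (S := S) (T := T) ?_ ?_ ?_
    · rw [Set.disjoint_left]
      rintro _ (⟨k, hk, rfl⟩ | ⟨k, hk, rfl⟩) h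
      · simp [T] at h; simp at hk; omega
      · simp [T] at h; simp at hk; omega
    · exact @Measurable.prodMk _ _ _ _ _ (_) _ _
        (@Measurable.indicator _ _ (_) _ _ _ _ (@measurable_const _ _ _ (_) _)
          (@measurableSet_alive _ _ _ _ _ (_) hA _ hD' hX')) (@measurable_remaining _ _ _ (_) _ hD')
    · exact @Measurable.prodMk _ _ _ _ _ (_) _ _
        (measurable_iSup_comap D X X₀ (i := Sum.inl n) (Or.inl rfl))
        (measurable_iSup_comap D X X₀ (i := Sum.inr (Sum.inl n)) (Or.inr rfl))
  have hmap := (indepFun_iff_map_prod_eq_prod_map_map hUm.aemeasurable hVm.aemeasurable).1 hUV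
  rw [show P.map V = (expMeasure lam).prod ν from hp.map_pair n] at hmap
  have hcomp : (alive D X A t n).indicator (fun ω => J (remaining D t n ω, D n ω, X n ω))
      = fun ω => F (U ω, V ω) := by
    ext ω
    by_cases hω : ω ∈ alive D X A t n <;> simp [hF, U, V, hω]
  have : IsProbabilityMeasure (P.map U) := Measure.isProbabilityMeasure_map hUm.aemeasurable
  have hFi : Integrable F ((P.map U).prod ((expMeasure lam).prod ν)) := by
    rw [← hmap, integrable_map_measure hFm.aestronglyMeasurable (hUm.prodMk hVm).aemeasurable]
    have := hint.indicator hal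
    rwa [hcomp] at this
  rw [← integral_indicator hal, hcomp,
    ← integral_map (φ := fun ω => (U ω, V ω)) (hUm.prodMk hVm).aemeasurable
      hFm.aestronglyMeasurable, hmap, integral_prod _ hFi,
    integral_map hUm.aemeasurable hFi.integral_prod_left.aestronglyMeasurable]
  refine integral_eq_zero_of_ae (ae_of_all _ fun ω => ?_)
  simp only [hF, Pi.zero_apply]
  rw [integral_const_mul, hJ0 _ (remaining_nonneg ht n ω), mul_zero]

/-- Following the policy for more and more offers yields the terminal reward in the limit. -/
lemma tendsto_integral_stopped [IsProbabilityMeasure P]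
    (hp : IsBiddingProcess P lam ν ν₀ D X X₀)
    (hlam : 0 < lam) (ht : 0 ≤ t) (hA : MeasurableSet A) {f : ℝ × ℝ → ℝ} {h : ℝ → ℝ}
    (hf : Measurable f) (hh : Measurable h) {C : ℝ} (hC : ∀ r, 0 ≤ r → r ≤ t → |h r| ≤ C)
    (hint : Integrable (fun ω => f (remaining D t (stopIndex D X A t ω + 1) ω,
      X (stopIndex D X A t ω) ω)) P) :
    (∀ n, Integrable (stopped D X A t f h n) P) ∧
    Tendsto (fun n => ∫ ω, stopped D X A t f h n ω ∂P) atTop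
      (𝓝 (∫ ω, f (remaining D t (stopIndex D X A t ω + 1) ω, X (stopIndex D X A t ω) ω) ∂P)) := by
  have hC0 : 0 ≤ C := (abs_nonneg _).trans (hC 0 le_rfl ht)
  have hm := fun n => measurable_stopped (t := t) hA hp.measurable_D hp.measurable_X hf hh n
  have hb : ∀ n, ∀ᵐ ω ∂P, ‖stopped D X A t f h n ω‖ ≤ ‖f (remaining D t (stopIndex D X A t ω + 1) ω,
      X (stopIndex D X A t ω) ω)‖ + C := by
    intro n
    filter_upwards [hp.ae_pos hlam] with ω hω
    rw [stopped]
    split_ifs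
    · have := hC _ (remaining_nonneg ht n ω) (remaining_le ht (fun k => (hω k).le) n)
      rw [Real.norm_eq_abs]
      linarith [norm_nonneg (f (remaining D t (stopIndex D X A t ω + 1) ω,
        X (stopIndex D X A t ω) ω))]
    · linarith
  have hbi := hint.norm.add (integrable_const C)
  refine ⟨fun n => hbi.mono' (hm n).aestronglyMeasurable (hb n),
    tendsto_integral_of_dominated_convergence _ (fun n => (hm n).aestronglyMeasurable) hbi hb ?_⟩
  filter_upwards [hp.ae_exists_remaining_eq_zero hlam ht] with ω hω
  refine tendsto_const_nhds.congr' ?_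
  filter_upwards [eventually_gt_atTop (stopIndex D X A t ω)] with n hn
  rw [stopped, if_neg (notMem_alive_of_lt hω hn)]

end IsBiddingProcess

/-! ### The value function and optimal policies -/

/-- The reward of a process that ends at remaining time `q.1` with offer `q.2`, the residual price
being replaced by its mean. -/
noncomputable def saleReward (μ₀ : ℝ) (q : ℝ × ℝ) : ℝ :=
  if q.1 = 0 then μ₀ else q.2

/-- The best of the two values available when the offer `q.2` arrives at remaining time `q.1`. -/
noncomputable def bestReward (μ₀ : ℝ) (m : ℝ → ℝ) (q : ℝ × ℝ) : ℝ :=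
  if q.1 = 0 then μ₀ else max q.2 (m q.1)

lemma measurable_saleReward (μ₀ : ℝ) : Measurable (saleReward μ₀) :=
  Measurable.ite (measurableSet_eq_fun measurable_fst measurable_const) measurable_const
    measurable_snd

lemma measurable_bestReward (μ₀ : ℝ) {m : ℝ → ℝ} (hm : Measurable m) :
    Measurable (bestReward μ₀ m) :=
  Measurable.ite (measurableSet_eq_fun measurable_fst measurable_const) measurable_const
    (measurable_snd.max (hm.comp measurable_fst))

lemma stepValue_le_bestReward (μ₀ : ℝ) (m : ℝ → ℝ) (A : Set (ℝ × ℝ))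
    (q : ℝ × ℝ) : stepValue A (saleReward μ₀) m q ≤ bestReward μ₀ m q := by
  rw [stepValue, saleReward, bestReward]
  split_ifs <;> simp_all

/-- Under the threshold rule for `m`, the better of the two values is always chosen. -/
lemma stepValue_threshold (μ₀ : ℝ) (m : ℝ → ℝ) {q : ℝ × ℝ} (hq : 0 ≤ q.1) :
    stepValue {q : ℝ × ℝ | 0 < q.1 ∧ m q.1 ≤ q.2} (saleReward μ₀) m q = bestReward μ₀ m q := by
  rw [stepValue, saleReward, bestReward]
  rcases hq.eq_or_lt with hq | hq
  · simp [← hq]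
  · by_cases hx : m q.1 ≤ q.2
    · simp [hq.ne', hq, hx]
    · simp [hq.ne', hq, hx, le_of_not_ge hx]

namespace IsCayleyMoserSolution

variable {lam : ℝ} {ν : Measure ℝ} {μ₀ : ℝ} {m : ℝ → ℝ}

lemma abs_bestReward_le (h : IsCayleyMoserSolution lam ν μ₀ m) (hμ₀ : 0 ≤ μ₀) {s t x : ℝ}
    (hs : 0 ≤ s) (hst : s ≤ t) : |bestReward μ₀ m (s, x)| ≤ max x 0 + m t := by
  have h1 := h.le_of_nonneg hs
  have h2 := h.strictMono.monotone hst
  have h3 := le_max_right x 0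
  have h4 := le_max_left x 0
  rw [bestReward]
  split_ifs
  · rw [abs_of_nonneg hμ₀]; linarith
  · rw [abs_of_nonneg (le_max_of_le_right (hμ₀.trans h1))]
    exact max_le (by linarith) (by linarith)

/-- The optimality equation: `m(r)` is the expected best reward at the next arrival. -/
lemma integral_bestReward [IsProbabilityMeasure ν] (hlam : 0 < lam)
    (hν : Integrable (fun x : ℝ => max x 0) ν) (h : IsCayleyMoserSolution lam ν μ₀ m)
    (hμ₀ : 0 ≤ μ₀) {r : ℝ} (hr : 0 ≤ r) :
    Integrable (fun v : ℝ × ℝ => bestReward μ₀ m (max (r - v.1) 0, v.2))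
      ((expMeasure lam).prod ν) ∧
    ∫ v, bestReward μ₀ m (max (r - v.1) 0, v.2) ∂((expMeasure lam).prod ν) = m r := by
  have := isProbabilityMeasure_expMeasure hlam
  have hmeas : Measurable fun v : ℝ × ℝ => bestReward μ₀ m (max (r - v.1) 0, v.2) :=
    (measurable_bestReward μ₀ h.continuous.measurable).comp (by fun_prop)
  have hpos : ∀ᵐ d ∂(expMeasure lam), 0 < d := by
    filter_upwards [measure_eq_zero_iff_ae_notMem.1 (expMeasure_Iic_zero hlam)] with d hd
    simpa using hd
  have hpos2 : ∀ᵐ v ∂((expMeasure lam).prod ν), 0 < v.1 :=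
    Measure.quasiMeasurePreserving_fst.ae hpos
  have hint : Integrable (fun v : ℝ × ℝ => bestReward μ₀ m (max (r - v.1) 0, v.2))
      ((expMeasure lam).prod ν) := by
    refine ((hν.comp_snd (expMeasure lam)).add (integrable_const (m r))).mono'
      hmeas.aestronglyMeasurable ?_
    filter_upwards [hpos2] with v hv
    exact h.abs_bestReward_le hμ₀ (le_max_right _ _) (max_le (by linarith) hr)
  refine ⟨hint, ?_⟩
  rw [integral_prod _ hint]
  have hc : Continuous fun s => m s + phi ν (m s) :=
    h.continuous.add ((continuous_phi hν).comp h.continuous)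
  rw [← integral_expMeasure_step hlam hr (h := m) (k := fun s => m s + phi ν (m s))
    h.continuous.continuousOn (fun s hs => ((h.hasDerivAt s hs.1.le).hasDerivWithinAt.congr_deriv
      (by ring))) (hc.intervalIntegrable _ _)]
  congr 1
  ext d
  rw [sub_zero]
  split_ifs with hd
  · have h1 : max (r - d) 0 = r - d := max_eq_left (by linarith)
    simp only [h1, bestReward, (sub_pos.2 hd).ne', if_false]
    exact integral_max_eq_add_phi hν _
  · have h1 : max (r - d) 0 = 0 := max_eq_right (by linarith)
    simp [h1, bestReward, h.zero]

end IsCayleyMoserSolution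

namespace IsBiddingProcess

variable {Ω : Type*} [mΩ : MeasurableSpace Ω] {P : Measure Ω} {lam : ℝ}
  {ν ν₀ : Measure ℝ} {D X : ℕ → Ω → ℝ} {X₀ : Ω → ℝ} {A : Set (ℝ × ℝ)} {t : ℝ} {m : ℝ → ℝ}

lemma integrable_X₀ (hp : IsBiddingProcess P lam ν ν₀ D X X₀)
    (hν₀ : Integrable (fun x : ℝ => x) ν₀) : Integrable X₀ P := by
  rw [← hp.law_X₀] at hν₀
  exact hν₀.comp_measurable hp.measurable_X₀

lemma integral_X₀ (hp : IsBiddingProcess P lam ν ν₀ D X X₀) :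
    ∫ ω, X₀ ω ∂P = ∫ x, x ∂ν₀ := by
  rw [← hp.law_X₀]
  exact (integral_map (f := fun x : ℝ => x) hp.measurable_X₀.aemeasurable (by fun_prop)).symm

/-- The residual price is independent of the offers and their times, so it can be replaced by its
mean in the computation of the expected sale price. -/
lemma integrable_salePrice_iff [IsProbabilityMeasure P]
    (hp : IsBiddingProcess P lam ν ν₀ D X X₀) (hν₀ : Integrable (fun x : ℝ => x) ν₀)
    (hA : MeasurableSet A) :
    (Integrable (salePrice D X X₀ A t) P ↔ Integrable (fun ω => saleReward (∫ x, x ∂ν₀)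
      (remaining D t (stopIndex D X A t ω + 1) ω, X (stopIndex D X A t ω) ω)) P) ∧
    (Integrable (salePrice D X X₀ A t) P → ∫ ω, salePrice D X X₀ A t ω ∂P =
      ∫ ω, saleReward (∫ x, x ∂ν₀)
        (remaining D t (stopIndex D X A t ω + 1) ω, X (stopIndex D X A t ω) ω) ∂P) := by
  set μ₀ := ∫ x, x ∂ν₀
  set R : Ω → ℝ := fun ω => remaining D t (stopIndex D X A t ω + 1) ω with hR
  have hRm : Measurable R := measurable_remaining_stopIndex hA hp.measurable_D hp.measurable_X
  set W : Ω → ℝ := fun ω => ({0} : Set ℝ).indicator (fun _ => 1) (R ω) * (X₀ ω - μ₀) with hW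
  have hind : IndepFun R X₀ P := by
    refine hp.indepFun_of_disjoint (S := {Sum.inr (Sum.inr ())}ᶜ) (T := {Sum.inr (Sum.inr ())})
      disjoint_compl_left ?_ (measurable_iSup_comap D X X₀ (mem_singleton _))
    refine @measurable_remaining_stopIndex _ _ _ _ _ (_) hA (fun k => ?_) fun k => ?_
    · exact measurable_iSup_comap D X X₀ (i := Sum.inl k) (by simp)
    · exact measurable_iSup_comap D X X₀ (i := Sum.inr (Sum.inl k)) (by simp)
  have hind' : IndepFun (fun ω => ({0} : Set ℝ).indicator (fun _ => (1 : ℝ)) (R ω))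
      (fun ω => X₀ ω - μ₀) P :=
    hind.comp (measurable_const.indicator (measurableSet_singleton 0)) (measurable_id.sub_const μ₀)
  have hX₀ := hp.integrable_X₀ hν₀
  have h1 : Integrable (fun ω => ({0} : Set ℝ).indicator (fun _ => (1 : ℝ)) (R ω)) P :=
    (integrable_const (1 : ℝ)).indicator (hRm (measurableSet_singleton 0))
  have h2 : Integrable (fun ω => X₀ ω - μ₀) P := hX₀.sub (integrable_const μ₀)
  have hWi : Integrable W P := hind'.integrable_mul h1 h2
  have hW0 : ∫ ω, W ω ∂P = 0 := by
    have h3 : ∫ ω, X₀ ω - μ₀ ∂P = 0 := by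
      rw [integral_sub hX₀ (integrable_const _), hp.integral_X₀]; simp [μ₀]
    rw [hW, hind'.integral_fun_mul_eq_mul_integral h1.aestronglyMeasurable h2.aestronglyMeasurable,
      h3, mul_zero]
  have heq : salePrice D X X₀ A t = fun ω => saleReward μ₀ (R ω, X (stopIndex D X A t ω) ω)
      + W ω := by
    ext ω
    by_cases h : R ω = 0
    · have h' := h
      simp only [hR] at h'
      simp [salePrice, saleReward, hW, h, h']
    · have h' := h
      simp only [hR] at h'
      simp [salePrice, saleReward, hW, h, h']
  have hiff : Integrable (salePrice D X X₀ A t) P ↔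
      Integrable (fun ω => saleReward μ₀ (R ω, X (stopIndex D X A t ω) ω)) P := by
    rw [heq]
    exact integrable_add_iff_integrable_left' hWi
  refine ⟨hiff, fun hi => ?_⟩
  rw [heq, integral_add (hiff.1 hi) hWi, hW0, add_zero]

lemma integrable_bestReward_remaining [IsProbabilityMeasure P]
    (hp : IsBiddingProcess P lam ν ν₀ D X X₀) (hlam : 0 < lam)
    (hν : Integrable (fun x : ℝ => max x 0) ν) {μ₀ : ℝ} (hμ₀ : 0 ≤ μ₀)
    (hm : IsCayleyMoserSolution lam ν μ₀ m) (ht : 0 ≤ t) (n : ℕ) :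
    Integrable (fun ω => bestReward μ₀ m (remaining D t (n + 1) ω, X n ω)
      - m (remaining D t n ω)) P := by
  have hmeas := fun n => measurable_remaining (t := t) (n := n) fun k _ => hp.measurable_D k
  have hXi : Integrable (fun ω => max (X n ω) 0) P := by
    rw [← hp.law_X n] at hν
    exact hν.comp_measurable (hp.measurable_X n)
  refine Integrable.sub ?_ ?_
  · refine (hXi.add (integrable_const (m t))).mono' ((measurable_bestReward μ₀
      hm.continuous.measurable).comp ((hmeas _).prodMk (hp.measurable_X n))).aestronglyMeasurable ?_
    filter_upwards [hp.ae_pos hlam] with ω hω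
    exact hm.abs_bestReward_le hμ₀ (remaining_nonneg ht _ ω)
      (remaining_le ht (fun k => (hω k).le) _)
  · refine (integrable_const (m t)).mono' (hm.continuous.measurable.comp
      (hmeas n)).aestronglyMeasurable ?_
    filter_upwards [hp.ae_pos hlam] with ω hω
    rw [Real.norm_of_nonneg (hμ₀.trans (hm.le_of_nonneg (remaining_nonneg ht _ ω)))]
    exact hm.strictMono.monotone (remaining_le ht (fun k => (hω k).le) _)

/-- The best reward at the next arrival has expectation `m` of the current remaining time. -/
lemma setIntegral_alive_bestReward [IsProbabilityMeasure P] [IsProbabilityMeasure ν]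
    (hp : IsBiddingProcess P lam ν ν₀ D X X₀) (hlam : 0 < lam)
    (hν : Integrable (fun x : ℝ => max x 0) ν) {μ₀ : ℝ} (hμ₀ : 0 ≤ μ₀)
    (hm : IsCayleyMoserSolution lam ν μ₀ m) (ht : 0 ≤ t) (hA : MeasurableSet A) (n : ℕ) :
    ∫ ω in alive D X A t n, (bestReward μ₀ m (remaining D t (n + 1) ω, X n ω)
      - m (remaining D t n ω)) ∂P = 0 := by
  have := isProbabilityMeasure_expMeasure hlam
  have hmm := hm.continuous.measurable
  have hbm := measurable_bestReward μ₀ hmm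
  refine hp.setIntegral_alive_eq_zero hlam ht hA
    (J := fun p => bestReward μ₀ m (max (p.1 - p.2.1) 0, p.2.2) - m p.1) (by fun_prop)
    (fun r hr => ?_) n (hp.integrable_bestReward_remaining hlam hν hμ₀ hm ht n)
  obtain ⟨h1, h2⟩ := hm.integral_bestReward hlam hν hμ₀ hr
  simp only
  rw [integral_sub h1 (integrable_const _), h2]
  simp

/-- No policy does better than `m(t)` on average. -/
lemma integral_saleReward_le [IsProbabilityMeasure P] [IsProbabilityMeasure ν]
    (hp : IsBiddingProcess P lam ν ν₀ D X X₀) (hlam : 0 < lam)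
    (hν : Integrable (fun x : ℝ => max x 0) ν) {μ₀ : ℝ} (hμ₀ : 0 ≤ μ₀)
    (hm : IsCayleyMoserSolution lam ν μ₀ m) (ht : 0 ≤ t) (hA : MeasurableSet A)
    (hint : Integrable (fun ω => saleReward μ₀ (remaining D t (stopIndex D X A t ω + 1) ω,
      X (stopIndex D X A t ω) ω)) P) :
    ∫ ω, saleReward μ₀ (remaining D t (stopIndex D X A t ω + 1) ω,
      X (stopIndex D X A t ω) ω) ∂P ≤ m t ∧
    (∫ ω, saleReward μ₀ (remaining D t (stopIndex D X A t ω + 1) ω,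
      X (stopIndex D X A t ω) ω) ∂P = m t → ∀ᵐ v ∂((expMeasure lam).prod ν),
        stepValue A (saleReward μ₀) m (max (t - v.1) 0, v.2)
          = bestReward μ₀ m (max (t - v.1) 0, v.2)) := by
  have hmm := hm.continuous.measurable
  obtain ⟨hYi, hYt⟩ := hp.tendsto_integral_stopped hlam ht hA (measurable_saleReward μ₀)
    hmm (C := m t) (fun r hr hrt => by
      rw [abs_of_nonneg (hμ₀.trans (hm.le_of_nonneg hr))]; exact hm.strictMono.monotone hrt) hint
  set Y := stopped D X A t (saleReward μ₀) m with hY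
  have hal : ∀ n, MeasurableSet (alive D X A t n) := fun n =>
    measurableSet_alive hA (fun k _ => hp.measurable_D k) fun k _ => hp.measurable_X k
  have hbi := fun n => hp.integrable_bestReward_remaining hlam hν hμ₀ hm ht n
  have hb0 := fun n => hp.setIntegral_alive_bestReward hlam hν hμ₀ hm ht hA n
  -- `Y (n + 1)` is at most what it would be if the better value were chosen at the next arrival
  have hanti : Antitone fun n => ∫ ω, Y n ω ∂P := by
    refine antitone_nat_of_succ_le fun n => ?_
    have h1 : ∫ ω, Y (n + 1) ω ∂P ≤ ∫ ω, (Y n ω + (alive D X A t n).indicator (fun ω =>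
        bestReward μ₀ m (remaining D t (n + 1) ω, X n ω) - m (remaining D t n ω)) ω) ∂P := by
      refine integral_mono (hYi _) ((hYi n).add ((hbi n).indicator (hal n))) fun ω => ?_
      simp only [hY, stopped_succ]
      gcongr
      exact stepValue_le_bestReward _ _ A _
    rwa [integral_add (hYi n) ((hbi n).indicator (hal n)), integral_indicator (hal n), hb0,
      add_zero] at h1
  have hle1 := hanti.le_of_tendsto hYt 1
  have hY1 : Y 1 = fun ω => stepValue A (saleReward μ₀) m (remaining D t 1 ω, X 0 ω) := by
    ext ω
    rw [hY, stopped_succ, stopped_zero, alive_zero, indicator_univ]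
    simp [remaining]
  have hbi0 : Integrable (fun ω => bestReward μ₀ m (remaining D t 1 ω, X 0 ω)) P := by
    refine ((hbi 0).add (integrable_const (m t))).congr (ae_of_all _ fun ω => ?_)
    simp [remaining]
  have hZ : ∫ ω, bestReward μ₀ m (remaining D t 1 ω, X 0 ω) ∂P = m t := by
    have h := hb0 0
    rw [alive_zero, setIntegral_univ] at h
    simp only [remaining] at h hbi0 ⊢
    rw [integral_sub hbi0 (integrable_const _)] at h
    simp at h
    linarith
  have hi1 := hYi 1
  simp only [hY1] at hle1 hi1
  have hle2 : ∫ ω, stepValue A (saleReward μ₀) m (remaining D t 1 ω, X 0 ω) ∂P ≤ m t := by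
    rw [← hZ]
    exact integral_mono hi1 hbi0 fun ω => stepValue_le_bestReward _ _ A _
  refine ⟨hle1.trans hle2, fun heq => ?_⟩
  have h0 : ∫ ω, (bestReward μ₀ m (remaining D t 1 ω, X 0 ω)
      - stepValue A (saleReward μ₀) m (remaining D t 1 ω, X 0 ω)) ∂P = 0 := by
    rw [integral_sub hbi0 hi1, hZ]
    linarith
  rw [integral_eq_zero_iff_of_nonneg
    (fun ω => sub_nonneg.2 (stepValue_le_bestReward _ _ A _)) (hbi0.sub hi1)] at h0
  have hsm := measurable_stepValue hA (measurable_saleReward μ₀) hmm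
  have hbm := measurable_bestReward μ₀ hmm
  rw [← hp.map_pair 0, ae_map_iff ((hp.measurable_D 0).prodMk (hp.measurable_X 0)).aemeasurable
    (measurableSet_eq_fun (by fun_prop) (by fun_prop))]
  filter_upwards [h0] with ω hω
  exact (sub_eq_zero.1 hω).symm

/-- The threshold rule for `m` achieves `m(t)`. Its sale price is nonnegative, so integrability
follows from Fatou's lemma. -/
lemma integral_saleReward_threshold [IsProbabilityMeasure P] [IsProbabilityMeasure ν]
    (hp : IsBiddingProcess P lam ν ν₀ D X X₀) (hlam : 0 < lam)
    (hν : Integrable (fun x : ℝ => max x 0) ν) {μ₀ : ℝ} (hμ₀ : 0 ≤ μ₀)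
    (hm : IsCayleyMoserSolution lam ν μ₀ m) (ht : 0 ≤ t)
    (hA' : A = {q : ℝ × ℝ | 0 < q.1 ∧ m q.1 ≤ q.2}) :
    MeasurableSet A ∧
    Integrable (fun ω => saleReward μ₀ (remaining D t (stopIndex D X A t ω + 1) ω,
      X (stopIndex D X A t ω) ω)) P ∧
    ∫ ω, saleReward μ₀ (remaining D t (stopIndex D X A t ω + 1) ω,
      X (stopIndex D X A t ω) ω) ∂P = m t := by
  have hmm := hm.continuous.measurable
  have hA : MeasurableSet A := by
    rw [hA']
    exact (measurableSet_lt measurable_const measurable_fst).inter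
      (measurableSet_le (hmm.comp measurable_fst) measurable_snd)
  set Y := stopped D X A t (saleReward μ₀) m with hY
  have hal : ∀ n, MeasurableSet (alive D X A t n) := fun n =>
    measurableSet_alive hA (fun k _ => hp.measurable_D k) fun k _ => hp.measurable_X k
  have hbi := fun n => hp.integrable_bestReward_remaining hlam hν hμ₀ hm ht n
  have hb0 := fun n => hp.setIntegral_alive_bestReward hlam hν hμ₀ hm ht hA n
  have hsucc : ∀ n, Y (n + 1) = fun ω => Y n ω + (alive D X A t n).indicator (fun ω =>
        bestReward μ₀ m (remaining D t (n + 1) ω, X n ω) - m (remaining D t n ω)) ω := by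
    intro n
    ext ω
    have h1 : ∀ ω, stepValue A (saleReward μ₀) m (remaining D t (n + 1) ω, X n ω)
        = bestReward μ₀ m (remaining D t (n + 1) ω, X n ω) := fun ω => by
      rw [hA']; exact stepValue_threshold _ _ (remaining_nonneg ht _ ω)
    simp only [hY, stopped_succ, h1]
  have hYE : ∀ n, Integrable (Y n) P ∧ ∫ ω, Y n ω ∂P = m t := by
    intro n
    induction n with
    | zero =>
      have : Y 0 = fun _ => m t := by ext ω; exact stopped_zero _ _ _
      rw [this]
      exact ⟨integrable_const _, by simp⟩
    | succ n ih =>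
      rw [hsucc]
      refine ⟨ih.1.add ((hbi n).indicator (hal n)), ?_⟩
      rw [integral_add ih.1 ((hbi n).indicator (hal n)), integral_indicator (hal n), hb0,
        add_zero, ih.2]
  have hFm : Measurable fun ω => saleReward μ₀ (remaining D t (stopIndex D X A t ω + 1) ω,
      X (stopIndex D X A t ω) ω) := (measurable_saleReward μ₀).comp
    ((measurable_remaining_stopIndex hA hp.measurable_D hp.measurable_X).prodMk
      (measurable_comp_stopIndex hA hp.measurable_D hp.measurable_X hp.measurable_X))
  have hF0 : ∀ᵐ ω ∂P, 0 ≤ saleReward μ₀ (remaining D t (stopIndex D X A t ω + 1) ω,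
      X (stopIndex D X A t ω) ω) := by
    filter_upwards [hp.ae_exists_remaining_eq_zero hlam ht] with ω hω
    rw [saleReward]
    split_ifs with h
    · exact hμ₀
    · have h1 := (stopIndex_spec (X := X) (A := A) hω).resolve_left h
      generalize stopIndex D X A t ω = N at h1
      rw [hA'] at h1
      exact (hμ₀.trans (hm.le_of_nonneg h1.1.le)).trans h1.2
  have hY0 : ∀ n, ∀ᵐ ω ∂P, 0 ≤ Y n ω := by
    intro n
    filter_upwards [hF0] with ω hω
    simp only [hY, stopped]
    split_ifs
    exacts [hμ₀.trans (hm.le_of_nonneg (remaining_nonneg ht _ ω)), hω]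
  have hint : Integrable (fun ω => saleReward μ₀ (remaining D t (stopIndex D X A t ω + 1) ω,
      X (stopIndex D X A t ω) ω)) P := by
    refine ⟨hFm.aestronglyMeasurable, ?_⟩
    have hlim : ∀ᵐ ω ∂P, ‖saleReward μ₀ (remaining D t (stopIndex D X A t ω + 1) ω,
        X (stopIndex D X A t ω) ω)‖ₑ = liminf (fun n => ‖Y n ω‖ₑ) atTop := by
      filter_upwards [hp.ae_exists_remaining_eq_zero hlam ht] with ω hω
      refine (Tendsto.liminf_eq (tendsto_const_nhds.congr' ?_)).symm
      filter_upwards [eventually_gt_atTop (stopIndex D X A t ω)] with n hn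
      rw [hY, stopped, if_neg (notMem_alive_of_lt hω hn)]
    rw [HasFiniteIntegral, lintegral_congr_ae hlim]
    refine (lintegral_liminf_le fun n => (measurable_stopped hA hp.measurable_D hp.measurable_X
      (measurable_saleReward μ₀) hmm n).enorm).trans_lt ?_
    have : ∀ n, ∫⁻ ω, ‖Y n ω‖ₑ ∂P = ENNReal.ofReal (m t) := fun n => by
      rw [← (hYE n).2, ofReal_integral_eq_lintegral_ofReal (hYE n).1 (hY0 n)]
      refine lintegral_congr_ae ?_
      filter_upwards [hY0 n] with ω hω
      rw [Real.enorm_of_nonneg hω]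
    simp_rw [hY] at this
    simp [this]
  refine ⟨hA, hint, ?_⟩
  obtain ⟨-, hYt⟩ := hp.tendsto_integral_stopped hlam ht hA (measurable_saleReward μ₀)
    hmm (C := m t) (fun r hr hrt => by
      rw [abs_of_nonneg (hμ₀.trans (hm.le_of_nonneg hr))]; exact hm.strictMono.monotone hrt) hint
  refine tendsto_nhds_unique hYt (tendsto_const_nhds.congr fun n => ?_)
  exact (hYE n).2.symm

variable [IsProbabilityMeasure P] [IsProbabilityMeasure ν]

/-- The value function is the solution of the Cayley–Moser equation. -/
lemma optimalValue_eq (hp : IsBiddingProcess P lam ν ν₀ D X X₀) (hlam : 0 < lam)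
    (hν : Integrable (fun x : ℝ => max x 0) ν) (hν₀ : Integrable (fun x : ℝ => x) ν₀)
    (hμ₀ : 0 ≤ ∫ x, x ∂ν₀) (hm : IsCayleyMoserSolution lam ν (∫ x, x ∂ν₀) m) (ht : 0 ≤ t) :
    optimalValue P D X X₀ t = m t := by
  obtain ⟨hA, hi, he⟩ := hp.integral_saleReward_threshold (t := t) hlam hν hμ₀ hm ht rfl
  obtain ⟨h1, h2⟩ := hp.integrable_salePrice_iff (t := t) hν₀ hA
  refine IsGreatest.csSup_eq ⟨⟨_, hA, h1.2 hi, ?_⟩, ?_⟩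
  · rw [h2 (h1.2 hi), he]
  · rintro v ⟨B, hB, hBi, rfl⟩
    obtain ⟨h3, h4⟩ := hp.integrable_salePrice_iff (t := t) hν₀ hB
    rw [h4 hBi]
    exact (hp.integral_saleReward_le hlam hν hμ₀ hm ht hB (h3.1 hBi)).1

lemma thresholdPolicy_eq (hp : IsBiddingProcess P lam ν ν₀ D X X₀) (hlam : 0 < lam)
    (hν : Integrable (fun x : ℝ => max x 0) ν) (hν₀ : Integrable (fun x : ℝ => x) ν₀)
    (hμ₀ : 0 ≤ ∫ x, x ∂ν₀) (hm : IsCayleyMoserSolution lam ν (∫ x, x ∂ν₀) m) :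
    thresholdPolicy P D X X₀ = {q : ℝ × ℝ | 0 < q.1 ∧ m q.1 ≤ q.2} := by
  ext q
  refine and_congr_right fun hq => ?_
  rw [hp.optimalValue_eq hlam hν hν₀ hμ₀ hm hq.le]

theorem isOptimalPolicy_threshold (hp : IsBiddingProcess P lam ν ν₀ D X X₀) (hlam : 0 < lam)
    (hν : Integrable (fun x : ℝ => max x 0) ν) (hν₀ : Integrable (fun x : ℝ => x) ν₀)
    (hμ₀ : 0 ≤ ∫ x, x ∂ν₀) (hm : IsCayleyMoserSolution lam ν (∫ x, x ∂ν₀) m) :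
    IsOptimalPolicy P D X X₀ (thresholdPolicy P D X X₀) := by
  rw [hp.thresholdPolicy_eq hlam hν hν₀ hμ₀ hm]
  have h := fun (t : ℝ) (ht : 0 ≤ t) =>
    hp.integral_saleReward_threshold (t := t) hlam hν hμ₀ hm ht rfl
  refine ⟨(h 0 le_rfl).1, fun t ht => ?_, fun t ht B hB hBi => ?_⟩
  · obtain ⟨hA, hi, he⟩ := h t ht
    exact (hp.integrable_salePrice_iff hν₀ hA).1.2 hi
  · obtain ⟨hA, hi, he⟩ := h t ht
    obtain ⟨h1, h2⟩ := hp.integrable_salePrice_iff (t := t) hν₀ hA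
    obtain ⟨h3, h4⟩ := hp.integrable_salePrice_iff (t := t) hν₀ hB
    rw [h4 hBi, h2 (h1.2 hi), he]
    exact (hp.integral_saleReward_le hlam hν hμ₀ hm ht hB (h3.1 hBi)).1

/-- An optimal policy uses the threshold `m` at almost every arrival. Ties are negligible because
`m` is injective and arrival times have no atoms. -/
lemma ae_mem_iff_of_isOptimalPolicy (hp : IsBiddingProcess P lam ν ν₀ D X X₀) (hlam : 0 < lam)
    (hν : Integrable (fun x : ℝ => max x 0) ν) (hν₀ : Integrable (fun x : ℝ => x) ν₀)
    (hμ₀ : 0 ≤ ∫ x, x ∂ν₀) (hm : IsCayleyMoserSolution lam ν (∫ x, x ∂ν₀) m)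
    (hopt : IsOptimalPolicy P D X X₀ A) (ht : 0 ≤ t) :
    ∀ᵐ v ∂((expMeasure lam).prod ν), v.1 < t → ((t - v.1, v.2) ∈ A ↔ m (t - v.1) < v.2) := by
  have := isProbabilityMeasure_expMeasure hlam
  have hmm := hm.continuous.measurable
  obtain ⟨hB, hBi, hBe⟩ := hp.integral_saleReward_threshold (t := t) hlam hν hμ₀ hm ht rfl
  obtain ⟨h1, h2⟩ := hp.integrable_salePrice_iff (t := t) hν₀ hB
  obtain ⟨h3, h4⟩ := hp.integrable_salePrice_iff (t := t) hν₀ hopt.measurableSet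
  have hi := hopt.integrable t ht
  have hle := hopt.le t ht _ hB (h1.2 hBi)
  rw [h2 (h1.2 hBi), h4 hi, hBe] at hle
  obtain ⟨h5, h6⟩ := hp.integral_saleReward_le hlam hν hμ₀ hm ht hopt.measurableSet (h3.1 hi)
  have htie : ∀ᵐ v ∂((expMeasure lam).prod ν), v.2 ≠ m (t - v.1) := by
    have hms : MeasurableSet {v : ℝ × ℝ | v.2 = m (t - v.1)} :=
      measurableSet_eq_fun measurable_snd (by fun_prop)
    suffices h0 : ((expMeasure lam).prod ν) {v : ℝ × ℝ | v.2 = m (t - v.1)} = 0 from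
      measure_eq_zero_iff_ae_notMem.1 h0
    rw [Measure.prod_apply_symm hms]
    refine lintegral_eq_zero_of_ae_eq_zero (ae_of_all _ fun x => ?_)
    refine expMeasure_absolutelyContinuous lam (Set.Subsingleton.measure_zero ?_ _)
    intro d hd d' hd'
    simp only [mem_preimage, mem_ofPred_eq] at hd hd'
    have := hm.strictMono.injective (hd.symm.trans hd')
    linarith
  filter_upwards [h6 (le_antisymm h5 hle), htie] with v hv htv hvt
  have hmax : max (t - v.1) 0 = t - v.1 := max_eq_left (by linarith)
  rw [hmax] at hv
  have hne : t - v.1 ≠ 0 := (sub_pos.2 hvt).ne'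
  by_cases hA : (t - v.1, v.2) ∈ A
  · simp only [stepValue, hne, hA, or_true, if_true, saleReward, bestReward, if_false] at hv
    exact iff_of_true hA (lt_of_le_of_ne (by rw [hv]; exact le_max_right _ _) (Ne.symm htv))
  · simp only [stepValue, hne, hA, or_false, bestReward, if_false] at hv
    exact iff_of_false hA (not_lt.2 (by rw [hv]; exact le_max_left _ _))

end IsBiddingProcess

/-! ### The law of the time to sale -/

section

/-- The indicator that the process ends with remaining time less than `b`. -/
noncomputable def lateReward (b : ℝ) (q : ℝ × ℝ) : ℝ := if q.1 < b then 1 else 0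

/-- The probability, from remaining time `r` on, that the process ends with remaining time less
than `b` under the threshold rule. -/
noncomputable def lateProb (ν : Measure ℝ) (m : ℝ → ℝ) (b r : ℝ) : ℝ :=
  if r < b then 1 else phi ν (m r) / phi ν (m b)

lemma measurable_lateReward (b : ℝ) : Measurable (lateReward b) :=
  Measurable.ite (measurableSet_lt measurable_fst measurable_const) measurable_const
    measurable_const

lemma abs_lateReward_le (b : ℝ) (q : ℝ × ℝ) : |lateReward b q| ≤ 1 := by
  rw [lateReward]; split_ifs <;> simp

lemma timeToSale_le {Ω : Type*} {D X : ℕ → Ω → ℝ} {A : Set (ℝ × ℝ)} {t : ℝ} (ht : 0 ≤ t)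
    (ω : Ω) : timeToSale D X A t ω ≤ t :=
  sub_le_self t (remaining_nonneg ht _ ω)

section

variable {lam : ℝ} {ν : Measure ℝ} [IsProbabilityMeasure ν] {μ₀ : ℝ} {m : ℝ → ℝ}

lemma measurable_lateProb (hν : Integrable (fun x : ℝ => max x 0) ν)
    (hm : IsCayleyMoserSolution lam ν μ₀ m) (b : ℝ) : Measurable (lateProb ν m b) :=
  Measurable.ite (measurableSet_lt measurable_id measurable_const) measurable_const
    (((continuous_phi hν).comp hm.continuous).measurable.div_const _)

lemma abs_lateProb_le (hν : Integrable (fun x : ℝ => max x 0) ν)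
    (hm : IsCayleyMoserSolution lam ν μ₀ m) (b r : ℝ) : |lateProb ν m b r| ≤ 1 := by
  rw [lateProb]
  split_ifs with h
  · simp
  · rw [abs_of_nonneg (div_nonneg (phi_nonneg _ _) (phi_nonneg _ _))]
    exact div_le_one_of_le₀ (antitone_phi hν (hm.strictMono.monotone (not_lt.1 h)))
      (phi_nonneg _ _)

lemma abs_stepValue_late_le (hν : Integrable (fun x : ℝ => max x 0) ν)
    (hm : IsCayleyMoserSolution lam ν μ₀ m) (A : Set (ℝ × ℝ)) (b : ℝ) (q : ℝ × ℝ) :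
    |stepValue A (lateReward b) (lateProb ν m b) q| ≤ 1 := by
  rw [stepValue]
  split_ifs
  exacts [abs_lateReward_le b q, abs_lateProb_le hν hm b _]

/-- The renewal equation for `lateProb`, which encodes `φ(m(r))' = -λ (1 - F(m(r))) φ(m(r))`. -/
lemma integral_stepValue_late (hlam : 0 < lam) (hν : Integrable (fun x : ℝ => max x 0) ν)
    (hm : IsCayleyMoserSolution lam ν μ₀ m) {A : Set (ℝ × ℝ)} (hA : MeasurableSet A) {b r : ℝ}
    (hb : 0 < b)
    (hAr : ∀ᵐ v ∂((expMeasure lam).prod ν), v.1 < r → ((r - v.1, v.2) ∈ A ↔ m (r - v.1) < v.2)) :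
    ∫ v, stepValue A (lateReward b) (lateProb ν m b) (max (r - v.1) 0, v.2)
      ∂((expMeasure lam).prod ν) = lateProb ν m b r := by
  have := isProbabilityMeasure_expMeasure hlam
  have hpos : ∀ᵐ d ∂(expMeasure lam), 0 < d := by
    filter_upwards [measure_eq_zero_iff_ae_notMem.1 (expMeasure_Iic_zero hlam)] with d hd
    simpa using hd
  have hpos2 : ∀ᵐ v ∂((expMeasure lam).prod ν), 0 < v.1 :=
    Measure.quasiMeasurePreserving_fst.ae hpos
  have hne : ∀ᵐ d ∂(expMeasure lam), d ≠ r - b := by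
    refine (expMeasure_absolutelyContinuous lam).ae_le ?_
    exact measure_eq_zero_iff_ae_notMem.1 (measure_singleton (r - b))
  have hne2 : ∀ᵐ v ∂((expMeasure lam).prod ν), v.1 ≠ r - b :=
    Measure.quasiMeasurePreserving_fst.ae hne
  have hone : ∀ v : ℝ × ℝ, r - v.1 < b →
      stepValue A (lateReward b) (lateProb ν m b) (max (r - v.1) 0, v.2) = 1 := fun v hv => by
    have : max (r - v.1) 0 < b := max_lt hv hb
    simp only [stepValue, lateReward, lateProb, this, if_true, ite_self]
  rcases lt_or_ge r b with hrb | hbr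
  · have h1 : ∫ v, stepValue A (lateReward b) (lateProb ν m b) (max (r - v.1) 0, v.2)
        ∂((expMeasure lam).prod ν) = ∫ _, (1 : ℝ) ∂((expMeasure lam).prod ν) := by
      refine integral_congr_ae ?_
      filter_upwards [hpos2] with v hv
      exact hone v (by linarith)
    rw [h1]
    simp [lateProb, hrb]
  · set g : ℝ → ℝ := fun s => phi ν (m s) / phi ν (m b) with hg
    have hgc : Continuous g := ((continuous_phi hν).comp hm.continuous).div_const _
    set G : ℝ × ℝ → ℝ := fun v => if v.1 < r - b then
      (Iic (m (r - v.1))).indicator (fun _ => g (r - v.1)) v.2 else 1 with hG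
    have hae : (fun v : ℝ × ℝ => stepValue A (lateReward b) (lateProb ν m b)
        (max (r - v.1) 0, v.2)) =ᵐ[(expMeasure lam).prod ν] G := by
      filter_upwards [hAr, hne2] with v hv hvne
      by_cases hd : v.1 < r - b
      · have h1 : b < r - v.1 := by linarith
        have h2 : max (r - v.1) 0 = r - v.1 := max_eq_left (by linarith)
        have h3 : r - v.1 ≠ 0 := by linarith
        simp only [hG, hd, if_true, h2, stepValue, h3, false_or, hv (by linarith), lateReward,
          lateProb, h1.not_gt, if_false, indicator, mem_Iic, ← not_lt, ite_not]
        rfl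
      · rw [hone v (by
          have := lt_of_le_of_ne (not_lt.1 hd) hvne.symm
          linarith)]
        simp [hG, hd]
    have hGi : Integrable G ((expMeasure lam).prod ν) := by
      refine Integrable.congr ?_ hae
      have hs := measurable_stepValue hA (measurable_lateReward b) (measurable_lateProb hν hm b)
      refine (integrable_const (1 : ℝ)).mono' (Measurable.aestronglyMeasurable (by fun_prop))
        (ae_of_all _ fun v => abs_stepValue_late_le hν hm A b _)
    rw [integral_congr_ae hae, integral_prod _ hGi]
    have hinner : ∀ d, ∫ x, G (d, x) ∂ν
        = if d < r - b then cdf ν (m (r - d)) * g (r - d) else g b := by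
      intro d
      by_cases hd : d < r - b
      · simp only [hG, hd, if_true]
        rw [integral_indicator_const _ measurableSet_Iic, cdf_eq_real, smul_eq_mul]
      · simp [hG, hd, hg, div_self (hm.phi_pos b).ne']
    simp_rw [hinner]
    have hgd : ∀ s ∈ Ioo b r,
        HasDerivWithinAt g (lam * (cdf ν (m s) * g s - g s)) (Ioi s) s := fun s hs => by
      have h1 := (hm.hasDerivWithinAt_phi_comp hν (hb.le.trans hs.1.le)).div_const (phi ν (m b))
      refine (h1.mono Ioi_subset_Ici_self).congr_deriv ?_
      simp only [hg]
      ring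
    rw [integral_expMeasure_step hlam hbr (h := g) (k := fun s => cdf ν (m s) * g s)
      hgc.continuousOn hgd ((((monotone_cdf ν).comp
        hm.strictMono.monotone).intervalIntegrable).mul_continuousOn hgc.continuousOn)]
    simp [lateProb, hbr.not_gt, hg]

end

variable {Ω : Type*} [MeasurableSpace Ω] {P : Measure Ω} {lam : ℝ}
  {ν ν₀ : Measure ℝ} {D X : ℕ → Ω → ℝ} {X₀ : Ω → ℝ} {A : Set (ℝ × ℝ)} {t : ℝ} {m : ℝ → ℝ}

lemma IsBiddingProcess.ae_timeToSale_nonneg (hp : IsBiddingProcess P lam ν ν₀ D X X₀)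
    (hlam : 0 < lam) (ht : 0 ≤ t) : ∀ᵐ ω ∂P, 0 ≤ timeToSale D X A t ω := by
  filter_upwards [hp.ae_pos hlam] with ω hω
  exact sub_nonneg.2 (remaining_le ht (fun k => (hω k).le) _)

/-- The law of the time to sale under an optimal policy. -/
theorem IsBiddingProcess.measureReal_lt_timeToSale [IsProbabilityMeasure P]
    [IsProbabilityMeasure ν] (hp : IsBiddingProcess P lam ν ν₀ D X X₀)
    (hlam : 0 < lam) (hν : Integrable (fun x : ℝ => max x 0) ν)
    (hν₀ : Integrable (fun x : ℝ => x) ν₀) (hμ₀ : 0 ≤ ∫ x, x ∂ν₀)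
    (hm : IsCayleyMoserSolution lam ν (∫ x, x ∂ν₀) m) (hopt : IsOptimalPolicy P D X X₀ A)
    {u : ℝ} (hu : 0 ≤ u) (hut : u < t) :
    P.real {ω | u < timeToSale D X A t ω} = phi ν (m t) / phi ν (m (t - u)) := by
  have := isProbabilityMeasure_expMeasure hlam
  have ht : 0 ≤ t := hu.trans hut.le
  have hA := hopt.measurableSet
  have hb : 0 < t - u := sub_pos.2 hut
  set b := t - u with hbdef
  have hfm := measurable_lateReward b
  have hhm := measurable_lateProb hν hm b
  have hsm := measurable_stepValue hA hfm hhm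
  have hRm := fun n => measurable_remaining (t := t) (n := n) fun k _ => hp.measurable_D k
  have hFm : Measurable fun ω => lateReward b (remaining D t (stopIndex D X A t ω + 1) ω,
      X (stopIndex D X A t ω) ω) := hfm.comp
    ((measurable_remaining_stopIndex hA hp.measurable_D hp.measurable_X).prodMk
      (measurable_comp_stopIndex hA hp.measurable_D hp.measurable_X hp.measurable_X))
  have hFi : Integrable (fun ω => lateReward b (remaining D t (stopIndex D X A t ω + 1) ω,
      X (stopIndex D X A t ω) ω)) P :=
    (integrable_const (1 : ℝ)).mono' hFm.aestronglyMeasurable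
      (ae_of_all _ fun ω => abs_lateReward_le b _)
  obtain ⟨hYi, hYt⟩ := hp.tendsto_integral_stopped hlam ht hA hfm hhm (C := 1)
    (fun r _ _ => abs_lateProb_le hν hm b r) hFi
  have hal : ∀ n, MeasurableSet (alive D X A t n) := fun n =>
    measurableSet_alive hA (fun k _ => hp.measurable_D k) fun k _ => hp.measurable_X k
  have hYE : ∀ n, ∫ ω, stopped D X A t (lateReward b) (lateProb ν m b) n ω ∂P
      = lateProb ν m b t := by
    intro n
    induction n with
    | zero => simp [stopped_zero]
    | succ n ih =>
      have hJi : Integrable (fun ω => stepValue A (lateReward b) (lateProb ν m b)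
          (remaining D t (n + 1) ω, X n ω) - lateProb ν m b (remaining D t n ω)) P := by
        refine Integrable.sub ?_ ?_
        · exact (integrable_const (1 : ℝ)).mono'
            (hsm.comp ((hRm _).prodMk (hp.measurable_X n))).aestronglyMeasurable
            (ae_of_all _ fun ω => abs_stepValue_late_le hν hm A b _)
        · exact (integrable_const (1 : ℝ)).mono' (hhm.comp (hRm n)).aestronglyMeasurable
            (ae_of_all _ fun ω => abs_lateProb_le hν hm b _)
      have h0 : ∫ ω in alive D X A t n, (stepValue A (lateReward b) (lateProb ν m b)
          (remaining D t (n + 1) ω, X n ω) - lateProb ν m b (remaining D t n ω)) ∂P = 0 := by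
        refine hp.setIntegral_alive_eq_zero hlam ht hA
          (J := fun p => stepValue A (lateReward b) (lateProb ν m b)
            (max (p.1 - p.2.1) 0, p.2.2) - lateProb ν m b p.1) (by fun_prop)
          (fun r hr => ?_) n hJi
        simp only
        rw [integral_sub _ (integrable_const _), integral_stepValue_late hlam hν hm hA hb
          (hp.ae_mem_iff_of_isOptimalPolicy hlam hν hν₀ hμ₀ hm hopt hr)]
        · simp
        · exact (integrable_const (1 : ℝ)).mono' (Measurable.aestronglyMeasurable (by fun_prop))
            (ae_of_all _ fun v => abs_stepValue_late_le hν hm A b _)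
      have h1 : stopped D X A t (lateReward b) (lateProb ν m b) (n + 1) = fun ω =>
          stopped D X A t (lateReward b) (lateProb ν m b) n ω + (alive D X A t n).indicator
            (fun ω => stepValue A (lateReward b) (lateProb ν m b)
              (remaining D t (n + 1) ω, X n ω) - lateProb ν m b (remaining D t n ω)) ω := by
        ext ω; exact stopped_succ _ _ _ _
      rw [h1, integral_add (hYi n) (hJi.indicator (hal n)), integral_indicator (hal n), h0,
        add_zero, ih]
  have hlim := tendsto_nhds_unique hYt (tendsto_const_nhds.congr fun n => (hYE n).symm)
  have hset : {ω | u < timeToSale D X A t ω}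
      = {ω | remaining D t (stopIndex D X A t ω + 1) ω < b} := by
    ext ω
    simp only [mem_ofPred_eq, timeToSale, hbdef]
    constructor <;> intro h <;> linarith
  have hind : (fun ω => lateReward b (remaining D t (stopIndex D X A t ω + 1) ω,
      X (stopIndex D X A t ω) ω))
      = {ω | remaining D t (stopIndex D X A t ω + 1) ω < b}.indicator fun _ => 1 := by
    ext ω
    simp [lateReward, indicator]
  rw [hind, integral_indicator_const _ (measurableSet_lt (measurable_remaining_stopIndex hA
    hp.measurable_D hp.measurable_X) measurable_const), smul_eq_mul, mul_one] at hlim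
  rw [hset, hlim, lateProb, if_neg (by linarith)]

end

/-! ### Regular variation of `φ ∘ m` -/

/-- A function whose derivative tends to `L` is asymptotically linear of slope `L`. -/
lemma tendsto_div_of_hasDerivAt {f f' : ℝ → ℝ} {L : ℝ}
    (hf : ∀ᶠ t in atTop, HasDerivAt f (f' t) t) (hL : Tendsto f' atTop (𝓝 L)) :
    Tendsto (fun t => f t / t) atTop (𝓝 L) := by
  rw [Metric.tendsto_atTop]
  intro ε hε
  obtain ⟨a, ha⟩ := eventually_atTop.1 ((hf.and (hL.eventually
    (Metric.closedBall_mem_nhds L (half_pos hε)))).and (eventually_gt_atTop 0))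
  have ha0 : 0 < a := (ha a le_rfl).2
  set C := |f a - L * a| with hC
  refine ⟨max a (2 * C / ε + 1), fun t ht => ?_⟩
  have hat : a ≤ t := (le_max_left _ _).trans ht
  have ht0 : 0 < t := ha0.trans_le hat
  have h1 : ‖(f t - L * t) - (f a - L * a)‖ ≤ ε / 2 * ‖t - a‖ := by
    refine (convex_Icc a t).norm_image_sub_le_of_norm_hasDerivWithin_le
      (f := fun s => f s - L * s) (f' := fun s => f' s - L) (fun s hs => ?_) (fun s hs => ?_)
      (left_mem_Icc.2 hat) (right_mem_Icc.2 hat)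
    · have h2 := ((hasDerivAt_id s).const_mul L).hasDerivWithinAt (s := Icc a t)
      exact ((ha s hs.1).1.1.hasDerivWithinAt.sub h2).congr_deriv (by simp)
    · exact (ha s hs.1).1.2
  rw [Real.norm_eq_abs, Real.norm_eq_abs, abs_of_nonneg (sub_nonneg.2 hat)] at h1
  have h2 : |f t - L * t| ≤ C + ε / 2 * (t - a) := by
    have := abs_sub_abs_le_abs_sub (f t - L * t) (f a - L * a)
    linarith
  have h3 : 2 * C < ε * t := by
    have : 2 * C / ε < t := by linarith [(le_max_right a (2 * C / ε + 1)).trans ht]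
    rw [div_lt_iff₀ hε] at this
    linarith
  have h4 : f t / t - L = (f t - L * t) / t := by field_simp
  rw [Real.dist_eq, h4, abs_div, abs_of_pos ht0, div_lt_iff₀ ht0]
  nlinarith

/-- A function whose logarithmic derivative is asymptotic to `ρ / t` is regularly varying of
index `ρ`. -/
lemma tendsto_div_comp_mul_of_hasDerivAt {f f' : ℝ → ℝ} {ρ r : ℝ} (hr : 0 < r) (hr1 : r ≤ 1)
    (hf : ∀ᶠ t in atTop, HasDerivAt f (f' t) t) (hpos : ∀ᶠ t in atTop, 0 < f t)
    (hρ : Tendsto (fun t => t * f' t / f t) atTop (𝓝 ρ)) :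
    Tendsto (fun t => f t / f (r * t)) atTop (𝓝 (r ^ (-ρ))) := by
  have key : Tendsto (fun t => Real.log (f t) - Real.log (f (r * t))) atTop
      (𝓝 (-ρ * Real.log r)) := by
    rw [Metric.tendsto_atTop]
    intro ε hε
    set δ := ε * r / 2 with hδ
    have hδ0 : 0 < δ := by positivity
    obtain ⟨a, ha⟩ := eventually_atTop.1 (((hf.and hpos).and (hρ.eventually
      (Metric.closedBall_mem_nhds ρ hδ0))).and (eventually_gt_atTop 0))
    have ha0 : 0 < a := (ha a le_rfl).2
    refine ⟨a / r, fun t ht => ?_⟩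
    have hat : a ≤ r * t := by rwa [ge_iff_le, div_le_iff₀' hr] at ht
    have hrt0 : 0 < r * t := ha0.trans_le hat
    have ht0 : 0 < t := pos_of_mul_pos_right hrt0 hr.le
    have hrt : r * t ≤ t := mul_le_of_le_one_left ht0.le hr1
    have h1 : ‖(Real.log (f t) - ρ * Real.log t)
        - (Real.log (f (r * t)) - ρ * Real.log (r * t))‖ ≤ δ / (r * t) * ‖t - r * t‖ := by
      refine (convex_Icc (r * t) t).norm_image_sub_le_of_norm_hasDerivWithin_le
        (f := fun s => Real.log (f s) - ρ * Real.log s)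
        (f' := fun s => (s * f' s / f s - ρ) / s) (fun s hs => ?_) (fun s hs => ?_)
        (left_mem_Icc.2 hrt) (right_mem_Icc.2 hrt)
      · obtain ⟨⟨⟨hd, hp⟩, -⟩, hs0⟩ := ha s (hat.trans hs.1)
        have h2 := (hd.log hp.ne').sub ((Real.hasDerivAt_log hs0.ne').const_mul ρ)
        refine h2.hasDerivWithinAt.congr_deriv ?_
        field_simp
      · obtain ⟨⟨-, hb⟩, hs0⟩ := ha s (hat.trans hs.1)
        rw [dist_eq_norm] at hb
        rw [norm_div, Real.norm_of_nonneg hs0.le]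
        exact div_le_div₀ hδ0.le hb hrt0 hs.1
    rw [Real.norm_eq_abs, Real.norm_eq_abs, abs_of_nonneg (sub_nonneg.2 hrt),
      Real.log_mul hr.ne' ht0.ne'] at h1
    have h2 : δ / (r * t) * (t - r * t) ≤ ε / 2 := by
      have : δ / (r * t) * (t - r * t) = ε / 2 * (1 - r) := by
        rw [hδ]; field_simp
      rw [this]
      nlinarith
    rw [Real.dist_eq]
    calc |Real.log (f t) - Real.log (f (r * t)) - -ρ * Real.log r|
        = |Real.log (f t) - ρ * Real.log t
          - (Real.log (f (r * t)) - ρ * (Real.log r + Real.log t))| := by ring_nf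
      _ ≤ ε / 2 := h1.trans h2
      _ < ε := half_lt_self hε
  have h3 := (Real.continuous_exp.tendsto _).comp key
  have h4 : Real.exp (-ρ * Real.log r) = r ^ (-ρ) := by
    rw [Real.rpow_def_of_pos hr, mul_comm]
  rw [h4] at h3
  have hrt : Tendsto (fun t : ℝ => r * t) atTop atTop := tendsto_id.const_mul_atTop hr
  refine h3.congr' ?_
  filter_upwards [hpos, hrt.eventually hpos] with t h5 h6
  simp only [Function.comp_apply]
  rw [Real.exp_sub, Real.exp_log h5, Real.exp_log h6]

/-- A function asymptotic to `C t ^ (-γ)` is regularly varying of index `-γ`. -/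
lemma tendsto_div_comp_mul_of_rpow {g : ℝ → ℝ} {γ C r : ℝ} (hr : 0 < r) (hC : C ≠ 0)
    (hg : Tendsto (fun t => g t * t ^ γ) atTop (𝓝 C)) :
    Tendsto (fun t => g t / g (r * t)) atTop (𝓝 (r ^ γ)) := by
  have hrt : Tendsto (fun t : ℝ => r * t) atTop atTop := tendsto_id.const_mul_atTop hr
  have h := ((hg.div (hg.comp hrt) hC)).mul_const (r ^ γ)
  rw [div_self hC, one_mul] at h
  refine h.congr' ?_
  filter_upwards [eventually_gt_atTop 0] with t ht
  have h1 : t ^ γ ≠ 0 := (Real.rpow_pos_of_pos ht γ).ne'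
  have h2 : r ^ γ ≠ 0 := (Real.rpow_pos_of_pos hr γ).ne'
  simp only [Pi.div_apply, Function.comp_apply]
  rw [Real.mul_rpow hr.le ht.le]
  by_cases h3 : g (r * t) = 0
  · simp [h3]
  · field_simp

section

variable {lam : ℝ} {ν : Measure ℝ} [IsProbabilityMeasure ν] {μ₀ : ℝ} {m : ℝ → ℝ}

/-- Near a finite top `M` of the support with `φ(x) ~ c (M - x)^(p+1)`, the function
`(M - m)^(-p)` has derivative tending to `p λ c`, so `φ(m(t))` is of order `t^(-(1 + 1/p))`. -/
lemma tendsto_phi_ratio_bounded (hlam : 0 < lam) (hν : Integrable (fun x : ℝ => max x 0) ν)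
    (hm : IsCayleyMoserSolution lam ν μ₀ m) {M p c : ℝ} (hp : 0 < p) (hc : 0 < c)
    (hM : supportMax ν = (M : EReal))
    (hlim : Tendsto (fun x : ℝ => phi ν x / (M - x) ^ (p + 1)) (𝓝[<] M) (𝓝 c))
    {r : ℝ} (hr : 0 < r) :
    Tendsto (fun t => phi ν (m t) / phi ν (m (r * t))) atTop (𝓝 (r ^ (1 + 1 / p))) := by
  have hiff : ∀ x, 0 < phi ν x ↔ x < M := fun x => by
    rw [phi_pos_iff hν, hM, EReal.coe_lt_coe_iff]
  have hlt : ∀ t, m t < M := fun t => (hiff _).1 (hm.phi_pos t)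
  have hmM : Tendsto m atTop (𝓝[<] M) := by
    refine tendsto_nhdsWithin_iff.2 ⟨tendsto_order.2 ⟨fun a ha => ?_, fun a ha => ?_⟩,
      Eventually.of_forall hlt⟩
    · obtain ⟨t₀, rfl⟩ := hm.surj a ((hiff a).2 ha)
      filter_upwards [eventually_gt_atTop t₀] with t ht
      exact hm.strictMono ht
    · exact Eventually.of_forall fun t => (hlt t).trans ha
  have h1 := hlim.comp hmM
  have hz : Tendsto (fun t => (M - m t) ^ (-p) / t) atTop (𝓝 (p * lam * c)) := by
    refine tendsto_div_of_hasDerivAt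
      (f' := fun t => p * lam * (phi ν (m t) / (M - m t) ^ (p + 1))) ?_ (h1.const_mul _)
    filter_upwards [eventually_ge_atTop 0] with t ht
    have hy : 0 < M - m t := sub_pos.2 (hlt t)
    have h2 := ((hm.hasDerivAt t ht).const_sub M).rpow_const (p := -p) (Or.inl hy.ne')
    refine h2.congr_deriv ?_
    have h3 : (M - m t) ^ (-p - 1) = ((M - m t) ^ (p + 1))⁻¹ := by
      rw [← Real.rpow_neg hy.le]; ring_nf
    rw [h3]
    ring
  have hκ : 0 < p * lam * c := by positivity
  refine tendsto_div_comp_mul_of_rpow (g := fun t => phi ν (m t))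
    (C := c * (p * lam * c) ^ (-(1 + 1 / p))) hr (by positivity) ?_
  refine (h1.mul (hz.rpow_const (p := -(1 + 1 / p)) (Or.inl hκ.ne'))).congr' ?_
  filter_upwards [eventually_gt_atTop 0] with t ht
  have hy : 0 < M - m t := sub_pos.2 (hlt t)
  have h4 : ((M - m t) ^ (-p)) ^ (-(1 + 1 / p)) = (M - m t) ^ (p + 1) := by
    rw [← Real.rpow_mul hy.le]
    congr 1
    field_simp
  have h5 : t ^ (-(1 + 1 / p)) = (t ^ (1 + 1 / p))⁻¹ := Real.rpow_neg ht.le _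
  have h6 := (Real.rpow_pos_of_pos hy (p + 1)).ne'
  simp only [Function.comp_apply]
  rw [Real.div_rpow (by positivity) ht.le, h4, h5]
  field_simp

lemma tendsto_atTop_of_supportMax_eq_top (hν : Integrable (fun x : ℝ => max x 0) ν)
    (hm : IsCayleyMoserSolution lam ν μ₀ m) (hM : supportMax ν = ⊤) : Tendsto m atTop atTop := by
  refine tendsto_atTop.2 fun a => ?_
  obtain ⟨t₀, rfl⟩ := hm.surj a ((phi_pos_iff hν a).2 (by rw [hM]; exact EReal.coe_lt_top a))
  filter_upwards [eventually_ge_atTop t₀] with t ht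
  exact hm.strictMono.monotone ht

/-- If the integral of `φ` over `(x, ∞)` does not vanish for large `x`, then `φ` is integrable and
the integral has derivative `-φ`. -/
lemma hasDerivAt_integral_phi (hν : Integrable (fun x : ℝ => max x 0) ν)
    (hne : ∀ᶠ x in atTop, ∫ u in Ioi x, phi ν u ≠ 0) (x : ℝ) :
    HasDerivAt (fun y => ∫ u in Ioi y, phi ν u) (-phi ν x) x := by
  have hcont := continuous_phi hν
  obtain ⟨a, ha⟩ := hne.exists
  have hia : IntegrableOn (phi ν) (Ioi a) := by
    by_contra h
    -- the integral of a function that is not integrable is `0` by convention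
    exact ha (integral_undef h)
  have hi : ∀ y, IntegrableOn (phi ν) (Ioi y) := fun y => by
    refine (hia.union (hcont.continuousOn.integrableOn_compact
      (isCompact_Icc (a := y) (b := a)))).mono_set ?_
    intro u hu
    rcases lt_or_ge a u with h | h
    · exact Or.inl h
    · exact Or.inr ⟨le_of_lt hu, h⟩
  have heq : (fun y => ∫ u in Ioi y, phi ν u) = fun y => (∫ u in Ioi x, phi ν u)
      - ∫ u in x..y, phi ν u := by
    ext y
    rw [← intervalIntegral.integral_Ioi_sub_Ioi' (hi x) (hi y)]
    ring
  rw [heq]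
  exact (intervalIntegral.integral_hasDerivAt_right (hcont.intervalIntegrable _ _)
    hcont.stronglyMeasurable.stronglyMeasurableAtFilter hcont.continuousAt).const_sub _

/-- For an exponential tail, with `Φ(x) = ∫_x^∞ φ`, the function `1 / Φ(m)` has derivative tending
to `λ c²`, so `φ(m(t)) ~ c Φ(m(t)) ~ 1 / (λ c t)`. -/
lemma tendsto_phi_ratio_exponential (hlam : 0 < lam) (hν : Integrable (fun x : ℝ => max x 0) ν)
    (hm : IsCayleyMoserSolution lam ν μ₀ m) {c : ℝ} (hc : 0 < c) (hM : supportMax ν = ⊤)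
    (hlim : Tendsto (fun x : ℝ => phi ν x / ∫ u in Ioi x, phi ν u) atTop (𝓝 c))
    {r : ℝ} (hr : 0 < r) :
    Tendsto (fun t => phi ν (m t) / phi ν (m (r * t))) atTop (𝓝 (r ^ (1 : ℝ))) := by
  have hmtop := tendsto_atTop_of_supportMax_eq_top hν hm hM
  have hne : ∀ᶠ x in atTop, ∫ u in Ioi x, phi ν u ≠ 0 := by
    filter_upwards [hlim.eventually (lt_mem_nhds hc)] with x hx h0
    simp [h0] at hx
  set Φ : ℝ → ℝ := fun x => ∫ u in Ioi x, phi ν u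
  have h1 : Tendsto (fun t => phi ν (m t) / Φ (m t)) atTop (𝓝 c) := hlim.comp hmtop
  have hz : Tendsto (fun t => (Φ (m t))⁻¹ / t) atTop (𝓝 (lam * c ^ 2)) := by
    refine tendsto_div_of_hasDerivAt
      (f' := fun t => lam * (phi ν (m t) / Φ (m t)) ^ 2) ?_ ((h1.pow 2).const_mul _)
    filter_upwards [eventually_ge_atTop 0, hmtop.eventually hne] with t ht hΦ
    have h2 := ((hasDerivAt_integral_phi hν hne (m t)).comp t (hm.hasDerivAt t ht)).inv hΦ
    refine h2.congr_deriv ?_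
    simp only [Function.comp_apply]
    change -(-phi ν (m t) * (lam * phi ν (m t))) / Φ (m t) ^ 2 = _
    rw [div_pow]
    ring
  have hκ : 0 < lam * c ^ 2 := by positivity
  refine tendsto_div_comp_mul_of_rpow (g := fun t => phi ν (m t))
    (C := c / (lam * c ^ 2)) hr (by positivity) ?_
  refine (h1.div hz hκ.ne').congr' ?_
  filter_upwards [eventually_gt_atTop 0, hmtop.eventually hne] with t ht hΦ
  have hΦ' : Φ (m t) ≠ 0 := hΦ
  simp only [Pi.div_apply, Real.rpow_one]
  field_simp

/-- For a power-law tail, with `Φ(x) = ∫_x^∞ φ`, the function `m² / Φ(m)` has derivative tending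
to `λ p (p + 2)`. Hence `t m'(t) / m(t) → 1 / (p + 2)`, which makes `m` regularly varying of index
`1 / (p + 2)` and `φ(m) = m' / λ` regularly varying of index `1 / (p + 2) - 1`. -/
lemma tendsto_phi_ratio_power (hlam : 0 < lam) (hν : Integrable (fun x : ℝ => max x 0) ν)
    (hm : IsCayleyMoserSolution lam ν μ₀ m) {p : ℝ} (hp : 0 < p) (hM : supportMax ν = ⊤)
    (hlim : Tendsto (fun x : ℝ => x * phi ν x / ∫ u in Ioi x, phi ν u) atTop (𝓝 p))
    {r : ℝ} (hr : 0 < r) (hr1 : r ≤ 1) :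
    Tendsto (fun t => phi ν (m t) / phi ν (m (r * t))) atTop (𝓝 (r ^ ((p + 1) / (p + 2)))) := by
  have hmtop := tendsto_atTop_of_supportMax_eq_top hν hm hM
  have hne : ∀ᶠ x in atTop, ∫ u in Ioi x, phi ν u ≠ 0 := by
    filter_upwards [hlim.eventually (lt_mem_nhds hp)] with x hx h0
    simp [h0] at hx
  set Φ : ℝ → ℝ := fun x => ∫ u in Ioi x, phi ν u
  have h1 : Tendsto (fun t => m t * phi ν (m t) / Φ (m t)) atTop (𝓝 p) := hlim.comp hmtop
  have hz : Tendsto (fun t => m t ^ 2 / Φ (m t) / t) atTop (𝓝 (lam * (2 * p + p ^ 2))) := by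
    refine tendsto_div_of_hasDerivAt
      (f' := fun t => lam * (2 * (m t * phi ν (m t) / Φ (m t))
        + (m t * phi ν (m t) / Φ (m t)) ^ 2)) ?_ (((h1.const_mul 2).add (h1.pow 2)).const_mul _)
    filter_upwards [eventually_ge_atTop 0, hmtop.eventually hne] with t ht hΦ
    have hΦ' : Φ (m t) ≠ 0 := hΦ
    have h2 := ((hm.hasDerivAt t ht).pow 2).div
      ((hasDerivAt_integral_phi hν hne (m t)).comp t (hm.hasDerivAt t ht)) hΦ
    refine h2.congr_deriv ?_
    simp only [Function.comp_apply, Pi.pow_apply]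
    change (_ * Φ (m t) - m t ^ 2 * (-phi ν (m t) * (lam * phi ν (m t)))) / Φ (m t) ^ 2 = _
    field_simp
    push_cast
    ring
  have hκ : 0 < lam * (2 * p + p ^ 2) := by positivity
  have hmpos : ∀ᶠ t in atTop, 0 < m t := hmtop.eventually_gt_atTop 0
  have hρ : Tendsto (fun t => t * (lam * phi ν (m t)) / m t) atTop (𝓝 (1 / (p + 2))) := by
    have h3 := (h1.const_mul lam).div hz hκ.ne'
    have h4 : lam * p / (lam * (2 * p + p ^ 2)) = 1 / (p + 2) := by
      field_simp
      ring
    rw [h4] at h3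
    refine h3.congr' ?_
    filter_upwards [eventually_gt_atTop 0, hmtop.eventually hne, hmpos] with t ht hΦ hmt
    have hΦ' : Φ (m t) ≠ 0 := hΦ
    simp only [Pi.div_apply]
    field_simp
  have hmreg := tendsto_div_comp_mul_of_hasDerivAt hr hr1
    ((eventually_ge_atTop 0).mono fun t ht => hm.hasDerivAt t ht) hmpos hρ
  have hrt : Tendsto (fun t : ℝ => r * t) atTop atTop := tendsto_id.const_mul_atTop hr
  have hρ0 : 1 / (p + 2) ≠ 0 := by positivity
  have h5 := ((hρ.div (hρ.comp hrt) hρ0).mul hmreg).mul_const r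
  have h6 : 1 / (p + 2) / (1 / (p + 2)) * r ^ (-(1 / (p + 2))) * r = r ^ ((p + 1) / (p + 2)) := by
    rw [div_self hρ0, one_mul]
    nth_rewrite 2 [← Real.rpow_one r]
    rw [← Real.rpow_add hr]
    congr 1
    field_simp
    ring
  rw [h6] at h5
  refine h5.congr' ?_
  filter_upwards [eventually_gt_atTop 0, hmpos, hrt.eventually hmpos] with t ht h7 h8
  have h9 := (hm.phi_pos (r * t)).ne'
  simp only [Pi.div_apply, Function.comp_apply]
  generalize m (r * t) = y at h8 h9 ⊢
  field_simp

end

/-! ### The limit law and its moments -/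

/-- The limit law: the law of `1 - U ^ (1 / γ)` for `U` uniform on `(0, 1]`. -/
noncomputable def limitLaw (γ : ℝ) : Measure ℝ :=
  (volume.restrict (Ioc (0 : ℝ) 1)).map fun u => 1 - u ^ (1 / γ)

lemma measurable_one_sub_rpow (γ : ℝ) : Measurable fun u : ℝ => 1 - u ^ (1 / γ) := by fun_prop

lemma isProbabilityMeasure_restrict_Ioc :
    IsProbabilityMeasure (volume.restrict (Ioc (0 : ℝ) 1)) := ⟨by simp⟩

instance isProbabilityMeasure_limitLaw (γ : ℝ) : IsProbabilityMeasure (limitLaw γ) :=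
  have := isProbabilityMeasure_restrict_Ioc
  Measure.isProbabilityMeasure_map (measurable_one_sub_rpow γ).aemeasurable

lemma cdf_limitLaw {γ : ℝ} (hγ : 0 < γ) (s : ℝ) : cdf (limitLaw γ) s = limitCDF γ s := by
  rw [cdf_eq_real, limitLaw, measureReal_def,
    Measure.map_apply (measurable_one_sub_rpow γ) measurableSet_Iic,
    Measure.restrict_apply (measurable_one_sub_rpow γ measurableSet_Iic), limitCDF]
  have hinv : 0 < 1 / γ := by positivity
  split_ifs with h0 h1
  · have : (fun u : ℝ => 1 - u ^ (1 / γ)) ⁻¹' Iic s ∩ Ioc 0 1 = ∅ := by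
      refine eq_empty_of_forall_notMem fun u hu => ?_
      have h2 := Real.rpow_le_one hu.2.1.le hu.2.2 hinv.le
      have h3 : 1 - u ^ (1 / γ) ≤ s := hu.1
      linarith
    rw [this]
    simp
  · push Not at h0
    have hs0 : 0 < 1 - s := by linarith
    have hs1 : (1 - s) ^ γ ≤ 1 := Real.rpow_le_one hs0.le (by linarith) hγ.le
    have : (fun u : ℝ => 1 - u ^ (1 / γ)) ⁻¹' Iic s ∩ Ioc 0 1 = Icc ((1 - s) ^ γ) 1 := by
      ext u
      simp only [mem_inter_iff, mem_preimage, mem_Iic, mem_Ioc, mem_Icc]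
      have key : ∀ u : ℝ, 0 < u → (1 - u ^ (1 / γ) ≤ s ↔ (1 - s) ^ γ ≤ u) := fun u hu => by
        have h2 : (u ^ (1 / γ)) ^ γ = u := by
          rw [← Real.rpow_mul hu.le, one_div_mul_cancel hγ.ne', Real.rpow_one]
        rw [sub_le_comm, ← Real.rpow_le_rpow_iff hs0.le (by positivity) hγ, h2]
      constructor
      · rintro ⟨h2, h3, h4⟩
        exact ⟨(key u h3).1 h2, h4⟩
      · rintro ⟨h2, h3⟩
        have hu : 0 < u := (Real.rpow_pos_of_pos hs0 γ).trans_le h2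
        exact ⟨(key u hu).2 h2, hu, h3⟩
    rw [this, Real.volume_Icc, ENNReal.toReal_ofReal (by linarith)]
  · have : (fun u : ℝ => 1 - u ^ (1 / γ)) ⁻¹' Iic s ∩ Ioc 0 1 = Ioc 0 1 := by
      refine inter_eq_right.2 fun u hu => ?_
      have := Real.rpow_nonneg hu.1.le (1 / γ)
      simp only [mem_preimage, mem_Iic]
      linarith
    rw [this]
    simp

/-- Truncation to the unit interval. -/
noncomputable def clamp (x : ℝ) : ℝ := max 0 (min x 1)

lemma clamp_eq_self {x : ℝ} (h0 : 0 ≤ x) (h1 : x ≤ 1) : clamp x = x := by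
  rw [clamp, min_eq_left h1, max_eq_right h0]

lemma clamp_mem (x : ℝ) : 0 ≤ clamp x ∧ clamp x ≤ 1 :=
  ⟨le_max_left _ _, max_le zero_le_one (min_le_right _ _)⟩

lemma continuous_clamp : Continuous clamp :=
  continuous_const.max (continuous_id.min continuous_const)

lemma continuous_clamp_pow (n : ℕ) : Continuous fun x => clamp x ^ n :=
  continuous_clamp.pow n

lemma intervalIntegrable_rpow_of_pos {a : ℝ} (ha : 0 < a) :
    IntervalIntegrable (fun u : ℝ => u ^ a) volume 0 1 :=
  intervalIntegral.intervalIntegrable_rpow' (by linarith)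

lemma integral_clamp_limitLaw {γ : ℝ} (hγ : 0 < γ) :
    ∫ x, clamp x ∂(limitLaw γ) = 1 / (γ + 1) := by
  have hinv : 0 < 1 / γ := by positivity
  rw [limitLaw, integral_map (measurable_one_sub_rpow γ).aemeasurable
    continuous_clamp.aestronglyMeasurable]
  have h1 : ∫ u in Ioc (0 : ℝ) 1, clamp (1 - u ^ (1 / γ))
      = ∫ u in (0 : ℝ)..1, (1 - u ^ (1 / γ)) := by
    rw [intervalIntegral.integral_of_le zero_le_one]
    refine setIntegral_congr_fun measurableSet_Ioc fun u hu => clamp_eq_self ?_ ?_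
    · exact sub_nonneg.2 (Real.rpow_le_one hu.1.le hu.2 hinv.le)
    · linarith [Real.rpow_nonneg hu.1.le (1 / γ)]
  rw [h1, intervalIntegral.integral_sub (by simp) (intervalIntegrable_rpow_of_pos hinv),
    integral_rpow (Or.inl (by linarith)), Real.one_rpow, Real.zero_rpow (by positivity)]
  simp only [intervalIntegral.integral_const, smul_eq_mul]
  field_simp
  ring

lemma integral_clamp_sq_limitLaw {γ : ℝ} (hγ : 0 < γ) :
    ∫ x, clamp x ^ 2 ∂(limitLaw γ) = 2 / ((γ + 1) * (γ + 2)) := by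
  have hinv : 0 < 1 / γ := by positivity
  have hinv2 : 0 < 2 / γ := by positivity
  rw [limitLaw, integral_map (measurable_one_sub_rpow γ).aemeasurable
    (continuous_clamp_pow 2).aestronglyMeasurable]
  have h1 : ∫ u in Ioc (0 : ℝ) 1, clamp (1 - u ^ (1 / γ)) ^ 2
      = ∫ u in (0 : ℝ)..1, (1 - 2 * u ^ (1 / γ) + u ^ (2 / γ)) := by
    rw [intervalIntegral.integral_of_le zero_le_one]
    refine setIntegral_congr_fun measurableSet_Ioc fun u hu => ?_
    have h2 : u ^ (2 / γ) = (u ^ (1 / γ)) ^ 2 := by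
      rw [← Real.rpow_natCast, ← Real.rpow_mul hu.1.le]
      congr 1
      push_cast
      ring
    have h3 : clamp (1 - u ^ (1 / γ)) = 1 - u ^ (1 / γ) := by
      refine clamp_eq_self ?_ ?_
      · exact sub_nonneg.2 (Real.rpow_le_one hu.1.le hu.2 hinv.le)
      · linarith [Real.rpow_nonneg hu.1.le (1 / γ)]
    simp only [h2, h3]
    ring
  have hi1 := intervalIntegrable_rpow_of_pos hinv
  have hi2 := intervalIntegrable_rpow_of_pos hinv2
  rw [h1, intervalIntegral.integral_add
      ((intervalIntegrable_const (c := (1 : ℝ))).sub (hi1.const_mul 2)) hi2,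
    intervalIntegral.integral_sub (by simp) (hi1.const_mul 2),
    intervalIntegral.integral_const_mul,
    integral_rpow (Or.inl (by linarith)), integral_rpow (Or.inl (by linarith)), Real.one_rpow,
    Real.one_rpow, Real.zero_rpow (by positivity), Real.zero_rpow (by positivity)]
  simp only [intervalIntegral.integral_const, smul_eq_mul]
  field_simp
  ring

/-- Convergence of the distribution functions at every point implies weak convergence. -/
lemma tendsto_probabilityMeasure_of_tendsto_cdf {ι : Type*} {l : Filter ι}
    [l.IsCountablyGenerated] {μ : ι → ProbabilityMeasure ℝ} {L : ProbabilityMeasure ℝ}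
    (h : ∀ s, Tendsto (fun i => (μ i : Measure ℝ).real (Iic s)) l
      (𝓝 ((L : Measure ℝ).real (Iic s)))) : Tendsto μ l (𝓝 L) := by
  refine (isPiSystem_Ioc (id : ℝ → ℝ) id).tendsto_probabilityMeasure_of_tendsto_of_mem ?_ ?_ ?_
  · rintro _ ⟨a, b, -, rfl⟩
    exact measurableSet_Ioc
  · intro u hu x hx
    obtain ⟨ε, hε, hball⟩ := Metric.isOpen_iff.1 hu x hx
    refine ⟨Ioc (x - ε / 2) (x + ε / 2), ⟨x - ε / 2, x + ε / 2, by simp only [id]; linarith, rfl⟩,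
      Ioc_mem_nhds (by linarith) (by linarith), fun y hy => hball ?_⟩
    rw [Metric.mem_ball, Real.dist_eq, abs_lt]
    constructor <;> linarith [hy.1, hy.2]
  · rintro _ ⟨a, b, hab, rfl⟩
    simp only [id] at hab ⊢
    rw [← NNReal.tendsto_coe]
    have hIoc : ∀ ν : ProbabilityMeasure ℝ, ((ν (Ioc a b) : NNReal) : ℝ)
        = (ν : Measure ℝ).real (Iic b) - (ν : Measure ℝ).real (Iic a) := fun ν => by
      have hdiff : Ioc a b = Iic b \ Iic a := by ext x; simp [and_comm]
      rw [hdiff, ← measureReal_sdiff (Iic_subset_Iic.2 hab.le) measurableSet_Iic]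
      rfl
    simp_rw [hIoc]
    exact (h b).sub (h a)

section

variable {Ω : Type*} [MeasurableSpace Ω] {P : Measure Ω} [IsProbabilityMeasure P]
  {T : ℝ → Ω → ℝ} {γ : ℝ}

lemma tendsto_measureReal_div_le {g : ℝ → ℝ} (hT : ∀ t, Measurable (T t))
    (h0 : ∀ t, 0 ≤ t → ∀ᵐ ω ∂P, 0 ≤ T t ω) (hle : ∀ t, 0 ≤ t → ∀ ω, T t ω ≤ t)
    (hlaw : ∀ t u, 0 ≤ u → u < t → P.real {ω | u < T t ω} = g t / g (t - u))
    (hg : ∀ r, 0 < r → r ≤ 1 → Tendsto (fun t => g t / g (r * t)) atTop (𝓝 (r ^ γ))) (s : ℝ) :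
    Tendsto (fun t : ℝ => P.real {ω | T t ω / t ≤ s}) atTop (𝓝 (limitCDF γ s)) := by
  rw [limitCDF]
  split_ifs with hs0 hs1
  · refine tendsto_const_nhds.congr' ?_
    filter_upwards [eventually_gt_atTop 0] with t ht
    have : P {ω | T t ω / t ≤ s} = 0 := by
      rw [measure_eq_zero_iff_ae_notMem]
      filter_upwards [h0 t ht.le] with ω hω h
      have h1 : T t ω / t ≤ s := h
      have := div_nonneg hω ht.le
      linarith
    simp [measureReal_def, this]
  · push Not at hs0
    have h1 := (hg (1 - s) (by linarith) (by linarith)).const_sub 1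
    refine h1.congr' ?_
    filter_upwards [eventually_gt_atTop 0] with t ht
    have hset : {ω | T t ω / t ≤ s} = {ω | s * t < T t ω}ᶜ := by
      ext ω
      simp only [mem_ofPred_eq, mem_compl_iff, not_lt, div_le_iff₀ ht]
    rw [hset, probReal_compl_eq_one_sub (measurableSet_lt measurable_const (hT t)),
      hlaw t (s * t) (by positivity) (by nlinarith)]
    ring_nf
  · refine tendsto_const_nhds.congr' ?_
    filter_upwards [eventually_gt_atTop 0] with t ht
    have : {ω | T t ω / t ≤ s} = univ := by
      refine eq_univ_of_forall fun ω => ?_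
      have : T t ω / t ≤ 1 := (div_le_one ht).2 (hle t ht.le ω)
      exact this.trans (not_lt.1 hs1)
    simp [this]

lemma tendstoInDistribution_div (hγ : 0 < γ) (hT : ∀ t, Measurable (T t))
    (hcdf : ∀ s, Tendsto (fun t : ℝ => P.real {ω | T t ω / t ≤ s}) atTop (𝓝 (limitCDF γ s))) :
    TendstoInDistribution (fun (t : ℝ) ω => T t ω / t) atTop (id : ℝ → ℝ) (fun _ => P)
      (limitLaw γ) := by
  refine ⟨fun t => ((hT t).div_const t).aemeasurable, aemeasurable_id, ?_⟩
  refine tendsto_probabilityMeasure_of_tendsto_cdf fun s => ?_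
  simp only [ProbabilityMeasure.coe_mk, Measure.map_id]
  rw [← cdf_eq_real, cdf_limitLaw hγ]
  refine (hcdf s).congr fun t => ?_
  rw [measureReal_def, measureReal_def, Measure.map_apply ((hT t).div_const t) measurableSet_Iic]
  rfl

/-- The distribution of `T t / t` converges as soon as `P(T t > u) = g(t) / g(t - u)` with `g`
regularly varying of index `-γ`; as `T t / t` takes values in `[0, 1]`, its moments converge too. -/
theorem hasScaledLimit_and_moments {g : ℝ → ℝ} (hγ : 0 < γ) (hT : ∀ t, Measurable (T t))
    (h0 : ∀ t, 0 ≤ t → ∀ᵐ ω ∂P, 0 ≤ T t ω) (hle : ∀ t, 0 ≤ t → ∀ ω, T t ω ≤ t)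
    (hlaw : ∀ t u, 0 ≤ u → u < t → P.real {ω | u < T t ω} = g t / g (t - u))
    (hg : ∀ r, 0 < r → r ≤ 1 → Tendsto (fun t => g t / g (r * t)) atTop (𝓝 (r ^ γ))) :
    HasScaledLimit P T γ ∧
    HasScaledMoments P T (1 / (γ + 1)) (γ / ((γ + 1) ^ 2 * (γ + 2))) := by
  have hcdf := tendsto_measureReal_div_le hT h0 hle hlaw hg
  have hdist := tendstoInDistribution_div hγ hT hcdf
  refine ⟨⟨hcdf, limitLaw γ, inferInstance, cdf_limitLaw hγ, hdist⟩, ?_⟩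
  have hLp : ∀ t : ℝ, 0 ≤ t → MemLp (T t) 2 P := fun t ht => by
    refine MemLp.of_bound (hT t).aestronglyMeasurable t ?_
    filter_upwards [h0 t ht] with ω hω
    rw [Real.norm_of_nonneg hω]
    exact hle t ht ω
  have hweak := fun f : BoundedContinuousFunction ℝ ℝ =>
    (ProbabilityMeasure.tendsto_iff_forall_integral_tendsto.1 hdist.tendsto) f
  have hclamp : ∀ t : ℝ, 0 < t → ∀ᵐ ω ∂P, clamp (T t ω / t) = T t ω / t := fun t ht => by
    filter_upwards [h0 t ht.le] with ω hω
    exact clamp_eq_self (div_nonneg hω ht.le) ((div_le_one ht).2 (hle t ht.le ω))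
  have hmoment : ∀ n : ℕ, Tendsto (fun t => ∫ ω, (T t ω / t) ^ n ∂P) atTop
      (𝓝 (∫ x, clamp x ^ n ∂(limitLaw γ))) := fun n => by
    have h1 := hweak (BoundedContinuousFunction.ofNormedAddCommGroup (fun x => clamp x ^ n)
      (continuous_clamp_pow n) 1 fun x => by
        rw [norm_pow, Real.norm_of_nonneg (clamp_mem x).1]
        exact pow_le_one₀ (clamp_mem x).1 (clamp_mem x).2)
    simp only [ProbabilityMeasure.coe_mk, Measure.map_id,
      BoundedContinuousFunction.coe_ofNormedAddCommGroup] at h1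
    refine h1.congr' ?_
    filter_upwards [eventually_gt_atTop 0] with t ht
    rw [integral_map ((hT t).div_const t).aemeasurable
      (continuous_clamp_pow n).aestronglyMeasurable]
    refine integral_congr_ae ?_
    filter_upwards [hclamp t ht] with ω hω
    rw [hω]
  have hm1 := hmoment 1
  have hm2 := hmoment 2
  simp only [pow_one] at hm1
  rw [integral_clamp_limitLaw hγ] at hm1
  rw [integral_clamp_sq_limitLaw hγ] at hm2
  have hvar : Tendsto (fun t : ℝ => variance (fun ω => T t ω / t) P) atTop
      (𝓝 (γ / ((γ + 1) ^ 2 * (γ + 2)))) := by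
    have h2 := hm2.sub (hm1.pow 2)
    have h3 : 2 / ((γ + 1) * (γ + 2)) - (1 / (γ + 1)) ^ 2 = γ / ((γ + 1) ^ 2 * (γ + 2)) := by
      field_simp
      ring
    rw [h3] at h2
    refine h2.congr' ?_
    filter_upwards [eventually_gt_atTop 0] with t ht
    have h4 : MemLp (fun ω => T t ω / t) 2 P := by
      simpa only [div_eq_mul_inv] using (hLp t ht.le).mul_const t⁻¹
    rw [variance_eq_sub h4]
    rfl
  refine ⟨hLp, ?_, hm1, ?_, hvar⟩
  · simpa only [integral_div] using hm1
  · refine hvar.congr fun t => ?_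
    have : (fun ω => T t ω / t) = fun ω => t⁻¹ * T t ω := by
      ext ω; rw [div_eq_inv_mul]
    rw [this, variance_const_mul, inv_pow, div_eq_inv_mul]

end

end CayleyMoser

/-! ### Optimality and the limits of the time to sale -/

theorem mainTheorem12 {Ω : Type*} [MeasurableSpace Ω] (P : Measure Ω) [IsProbabilityMeasure P]
    (lam : ℝ) (hlam : 0 < lam)
    (ν ν₀ : Measure ℝ) [IsProbabilityMeasure ν] [IsProbabilityMeasure ν₀]
    (hν : Integrable (fun x : ℝ => max x 0) ν) (hν₀ : Integrable (fun x : ℝ => x) ν₀)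
    (hμ₀ : 0 ≤ ∫ x, x ∂ν₀)
    (hμ₀M : ((∫ x, x ∂ν₀ : ℝ) : EReal) < CayleyMoser.supportMax ν)
    (D X : ℕ → Ω → ℝ) (X₀ : Ω → ℝ)
    (hproc : CayleyMoser.IsBiddingProcess P lam ν ν₀ D X X₀) :
    CayleyMoser.IsOptimalPolicy P D X X₀ (CayleyMoser.thresholdPolicy P D X X₀) ∧
    ∀ A : Set (ℝ × ℝ), CayleyMoser.IsOptimalPolicy P D X X₀ A →
      -- support bounded from above
      (∀ M p c : ℝ, 0 < p → 0 < c → CayleyMoser.supportMax ν = (M : EReal) →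
        Tendsto (fun x : ℝ => CayleyMoser.phi ν x / (M - x) ^ (p + 1)) (𝓝[<] M) (𝓝 c) →
        CayleyMoser.HasScaledLimit P (CayleyMoser.timeToSale D X A) (1 + 1 / p) ∧
        CayleyMoser.HasScaledMoments P (CayleyMoser.timeToSale D X A)
          (p / (2 * p + 1)) (p ^ 2 * (p + 1) / ((2 * p + 1) ^ 2 * (3 * p + 1)))) ∧
      -- exponential tail
      (∀ c : ℝ, 0 < c → CayleyMoser.supportMax ν = ⊤ →
        Tendsto (fun x : ℝ => CayleyMoser.phi ν x / ∫ u in Ioi x, CayleyMoser.phi ν u)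
          atTop (𝓝 c) →
        CayleyMoser.HasScaledLimit P (CayleyMoser.timeToSale D X A) 1 ∧
        CayleyMoser.HasScaledMoments P (CayleyMoser.timeToSale D X A) (1 / 2) (1 / 12)) ∧
      -- power-law tail
      (∀ p : ℝ, 0 < p → CayleyMoser.supportMax ν = ⊤ →
        Tendsto (fun x : ℝ => x * CayleyMoser.phi ν x / ∫ u in Ioi x, CayleyMoser.phi ν u)
          atTop (𝓝 p) →
        CayleyMoser.HasScaledLimit P (CayleyMoser.timeToSale D X A) ((p + 1) / (p + 2)) ∧
        CayleyMoser.HasScaledMoments P (CayleyMoser.timeToSale D X A)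
          ((p + 2) / (2 * p + 3))
          ((p + 1) * (p + 2) ^ 2 / ((3 * p + 5) * (2 * p + 3) ^ 2))) := by
  have h0 : 0 < CayleyMoser.phi ν (∫ x, x ∂ν₀) := (CayleyMoser.phi_pos_iff hν _).2 hμ₀M
  obtain ⟨m, hm⟩ := CayleyMoser.exists_isCayleyMoserSolution hlam hν h0
  refine ⟨hproc.isOptimalPolicy_threshold hlam hν hν₀ hμ₀ hm, fun A hopt => ?_⟩
  have key := fun (γ : ℝ) (hγ : 0 < γ) => CayleyMoser.hasScaledLimit_and_moments (P := P)
    (T := CayleyMoser.timeToSale D X A) (g := fun t => CayleyMoser.phi ν (m t)) hγ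
    (fun t => CayleyMoser.measurable_timeToSale hopt.measurableSet hproc.measurable_D
      hproc.measurable_X)
    (fun t ht => hproc.ae_timeToSale_nonneg hlam ht)
    (fun t ht ω => CayleyMoser.timeToSale_le ht ω)
    (fun t u hu hut => hproc.measureReal_lt_timeToSale hlam hν hν₀ hμ₀ hm hopt hu hut)
  refine ⟨fun M p c hp hc hM hlim => ?_, fun c hc hM hlim => ?_, fun p hp hM hlim => ?_⟩
  · have h := key (1 + 1 / p) (by positivity) fun r hr _ =>
      CayleyMoser.tendsto_phi_ratio_bounded hlam hν hm hp hc hM hlim hr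
    have e1 : 1 / (1 + 1 / p + 1) = p / (2 * p + 1) := by
      field_simp
      ring
    have e2 : (1 + 1 / p) / ((1 + 1 / p + 1) ^ 2 * (1 + 1 / p + 2))
        = p ^ 2 * (p + 1) / ((2 * p + 1) ^ 2 * (3 * p + 1)) := by
      field_simp
      ring
    rwa [e1, e2] at h
  · have h := key 1 one_pos fun r hr _ =>
      CayleyMoser.tendsto_phi_ratio_exponential hlam hν hm hc hM hlim hr
    norm_num at h ⊢
    exact h
  · have h := key ((p + 1) / (p + 2)) (by positivity) fun r hr hr1 =>
      CayleyMoser.tendsto_phi_ratio_power hlam hν hm hp hM hlim hr hr1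
    have e1 : 1 / ((p + 1) / (p + 2) + 1) = (p + 2) / (2 * p + 3) := by
      field_simp
      ring
    have e2 : (p + 1) / (p + 2) / (((p + 1) / (p + 2) + 1) ^ 2 * ((p + 1) / (p + 2) + 2))
        = (p + 1) * (p + 2) ^ 2 / ((3 * p + 5) * (2 * p + 3) ^ 2) := by
      field_simp
      ring
    rwa [e1, e2] at h
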